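/- Let $k\ge 1$. A $k$-ribbon is a connected skew diagram with $k$ cells containing no $2\times 2$ square; its height $h(R)$ is the number of rows it meets, its spin is $s(R)=\frac{h(R)-1}{2}$, and (in French notation, with the largest part at the bottom) its initial cell is its rightmost and bottommost cell. For partitions $\alpha\subseteq\beta$, the skew shape $\beta/\alpha$ is a horizontal $k$-ribbon strip of weight $m$ if it can be tiled by $m$ $k$-ribbons the initial cell of each of which is the bottom cell of its column in $\beta/\alpha$; such a tiling is unique. A $k$-ribbon tableau $T$ of shape $\lambda$ and weight $\mu=(\mu_1,\mu_2,\ldots)$ (non-negative integers, finitely many nonzero) is a chain of partitions $\emptyset=\alpha^0\subseteq\alpha^1\subseteq\alpha^2\subseteq\cdots$, eventually constant and equal to $\lambda$, such that $\alpha^i/\alpha^{i-1}$ is a horizontal $k$-ribbon strip of weight $\mu_i$ for every $i\ge 1$. Put $x^T=x_1^{\mu_1}x_2^{\mu_2}\cdots$, let the spin $s(T)$ be the sum of the spins of the ribbons of $T$, let $s_k^*(\lambda)$ be the maximum of $s(T)$ over all $k$-ribbon tableaux $T$ of shape $\lambda$ (of any weight), and let $\tilde s(T)=s_k^*(\lambda)-s(T)$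 be the cospin of a tableau $T$ of shape $\lambda$. Let $\mathrm{Tab}_k(\lambda,\cdot)$ be the set of all $k$-ribbon tableaux of shape $\lambda$; it is empty unless $\lambda$ has empty $k$-core. For a partition $\mu=(\mu_1,\mu_2,\ldots)$ write $k\mu=(k\mu_1,k\mu_2,\ldots)$. Define $$\tilde G^{(k)}_\lambda(X;q)=\sum_{T\in \mathrm{Tab}_k(\lambda,\cdot)}q^{\tilde s(T)}x^T,\qquad \tilde H^{(k)}_\mu(X;q)=\tilde G^{(k)}_{k\mu}(X;q),\qquad H^{(k)}_\mu(X;q)=\sum_{T\in \mathrm{Tab}_k(k\mu,\cdot)}q^{s(T)}x^T .$$ **Theorem (symmetry).** For all partitions $\lambda$ and $\mu$, the cospin of every $k$-ribbon tableau of shape $\lambda$ and the spin of every $k$-ribbon tableau of shape $k\mu$ are non-negative integers, and $\tilde G^{(k)}_\lambda$, $\tilde H^{(k)}_\mu$ and $H^{(k)}_\mu$ are symmetric functions of $X=(x_1,x_2,\ldots)$, i.e. they have bounded degree and are invariant under all permutations of the variables. -/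

import Mathlib

namespace RibbonTableaux

/-- A cell `(i, j)` lies in row `i` and column `j`, both counted from `0`; row `0` contains the
largest part.  In the French convention (rows drawn upwards) "bottom" means small row index and
"right" means large column index. -/
abbrev Cell := ℕ × ℕ

/-- `R` is a `k`-ribbon: the set of cells of a sequence of `k` cells in which each step goes one
cell up (next row, same column) or one cell to the left (same row, previous column).  Equivalently,
`R` is a connected skew diagram with `k` cells that contains no `2 × 2` square. -/
def IsRibbon (k : ℕ) (R : Finset Cell) : Prop :=
  ∃ c : ℕ → Cell, R = (Finset.range k).image c ∧
    ∀ i, i + 1 < k →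
      (c (i + 1) = ((c i).1 + 1, (c i).2) ∨ c i = ((c (i + 1)).1, (c (i + 1)).2 + 1))

/-- The initial cell of a ribbon is its rightmost and bottommost cell. -/
def IsInitialCell (a : Cell) (R : Finset Cell) : Prop :=
  a ∈ R ∧ ∀ b ∈ R, a.1 ≤ b.1 ∧ b.2 ≤ a.2

/-- The height of a ribbon: the number of rows that it meets. -/
def height (R : Finset Cell) : ℕ := (R.image Prod.fst).card

/-- The spin `(h(R) - 1) / 2` of a ribbon. -/
def ribbonSpin (R : Finset Cell) : ℚ := ((height R : ℚ) - 1) / 2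

/-- `P` is a tiling of the skew shape `β / α` by `k`-ribbons whose initial cells lie in
`α₊ / α`, where `α₊` is obtained from `α` by adding a part equal to the largest part of `β`.
A cell `(i, j)` of `β / α` lies in `α₊ / α` iff it is the lowest cell of its column outside `α`,
that is, iff `i` is the length of the column `j` of `α`. -/
structure IsHorizontalStripTiling (k : ℕ) (α β : YoungDiagram) (P : Finset (Finset Cell)) :
    Prop where
  le : α ≤ β
  ribbon : ∀ R ∈ P, IsRibbon k R
  disjoint : (P : Set (Finset Cell)).PairwiseDisjoint id
  cover : P.biUnion id = β.cells \ α.cells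
  initial : ∀ R ∈ P, ∃ a, IsInitialCell a R ∧ a.1 = α.colLen a.2

/-- A `k`-ribbon tableau of shape `lam` and weight `μ = (μ 0, μ 1, …)`: a chain of partitions from
the empty one to `lam`, each step of which is a horizontal `k`-ribbon strip with `μ i` ribbons
(those that carry the label `i`).  The tableau records the ribbons of each strip; a horizontal
ribbon strip has only one tiling of the required kind, so they are determined by the chain. -/
@[ext]
structure Tab (k : ℕ) (lam : YoungDiagram) (μ : ℕ →₀ ℕ) where
  chain : ℕ → YoungDiagram
  ribbons : ℕ → Finset (Finset Cell)
  chain_zero : chain 0 = ⊥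
  strip : ∀ i, IsHorizontalStripTiling k (chain i) (chain (i + 1)) (ribbons i)
  weight : ∀ i, (ribbons i).card = μ i
  top : ∃ N, ∀ i, N ≤ i → chain i = lam

/-- The spin of a ribbon tableau is the sum of the spins of its ribbons (there are no ribbons
with a label outside the support of the weight). -/
def Tab.spin {k : ℕ} {lam : YoungDiagram} {μ : ℕ →₀ ℕ} (T : Tab k lam μ) : ℚ :=
  ∑ i ∈ μ.support, ∑ R ∈ T.ribbons i, ribbonSpin R

/-- The set of spins of all `k`-ribbon tableaux of shape `lam`, of any weight. -/
def spins (k : ℕ) (lam : YoungDiagram) : Set ℚ :=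
  {s | ∃ (μ : ℕ →₀ ℕ) (T : Tab k lam μ), T.spin = s}

/-- The maximum of `spins k lam`, taken in `½ℕ`; see `isGreatest_maxSpin`. -/
noncomputable def maxSpin (k : ℕ) (lam : YoungDiagram) : ℚ :=
  ((sSup {m : ℕ | (m : ℚ) / 2 ∈ spins k lam} : ℕ) : ℚ) / 2

/-- The cospin of a ribbon tableau. -/
noncomputable def Tab.cospin {k : ℕ} {lam : YoungDiagram} {μ : ℕ →₀ ℕ} (T : Tab k lam μ) : ℚ :=
  maxSpin k lam - T.spin

/-- The partition `kμ = (kμ₁, kμ₂, …)`. -/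
def stretch (k : ℕ) (μ : YoungDiagram) : YoungDiagram where
  cells := (Finset.range (μ.colLen 0) ×ˢ Finset.range (k * μ.rowLen 0)).filter
    fun c => c.2 < k * μ.rowLen c.1
  isLowerSet := by
    rintro ⟨i, j⟩ ⟨i', j'⟩ h hc
    obtain ⟨h1, h2⟩ := Prod.mk_le_mk.1 h
    simp only [Finset.coe_filter, Finset.mem_product, Finset.mem_range, Set.mem_ofPred_eq] at hc ⊢
    have h3 := Nat.mul_le_mul_left k (μ.rowLen_anti i' i h1)
    omega

theorem rowLen_stretch (k : ℕ) (μ : YoungDiagram) (i : ℕ) :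
    (stretch k μ).rowLen i = k * μ.rowLen i := by
  have key : ∀ j, j < (stretch k μ).rowLen i ↔ j < k * μ.rowLen i := by
    intro j
    rw [← YoungDiagram.mem_iff_lt_rowLen, ← YoungDiagram.mem_cells]
    simp only [stretch, Finset.mem_filter, Finset.mem_product, Finset.mem_range]
    refine ⟨fun h => h.2, fun h => ⟨⟨?_, ?_⟩, h⟩⟩
    · rw [← YoungDiagram.mem_iff_lt_colLen, YoungDiagram.mem_iff_lt_rowLen]
      exact Nat.pos_of_mul_pos_left (lt_of_le_of_lt (Nat.zero_le _) h)
    · exact lt_of_lt_of_le h (Nat.mul_le_mul_left k (μ.rowLen_anti 0 i (Nat.zero_le _)))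
  have h1 := key (k * μ.rowLen i)
  have h2 := key ((stretch k μ).rowLen i)
  omega

section Finiteness

variable {k : ℕ} {lam : YoungDiagram} {μ : ℕ →₀ ℕ}

theorem Tab.mono (T : Tab k lam μ) : Monotone T.chain :=
  monotone_nat_of_le_succ fun i => (T.strip i).le

theorem Tab.chain_le (T : Tab k lam μ) (i : ℕ) : T.chain i ≤ lam := by
  obtain ⟨N, hN⟩ := T.top
  exact (T.mono (le_max_right N i)).trans (hN (max N i) (le_max_left _ _)).le

theorem Tab.ribbons_eq_empty (T : Tab k lam μ) {i : ℕ} (h : μ i = 0) : T.ribbons i = ∅ := by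
  rw [← Finset.card_eq_zero, T.weight, h]

theorem Tab.chain_succ_eq (T : Tab k lam μ) {i : ℕ} (h : μ i = 0) :
    T.chain (i + 1) = T.chain i := by
  refine le_antisymm ?_ (T.strip i).le
  have h1 := (T.strip i).cover
  rw [T.ribbons_eq_empty h, Finset.biUnion_empty] at h1
  exact YoungDiagram.cells_subset_iff.1 (Finset.sdiff_eq_empty_iff_subset.1 h1.symm)

theorem Tab.chain_eq (T : Tab k lam μ) {N : ℕ} (hN : ∀ i, N ≤ i → μ i = 0) {i : ℕ} (hi : N ≤ i) :
    T.chain i = lam := by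
  obtain ⟨M, hM⟩ := T.top
  have h : ∀ j, T.chain (i + j) = T.chain i := by
    intro j
    induction j with
    | zero => rfl
    | succ j ih => rw [← add_assoc, T.chain_succ_eq (hN _ (by omega)), ih]
  rw [← h M]
  exact hM _ (by omega)

theorem exists_bound (μ : ℕ →₀ ℕ) : ∃ N, ∀ i, N ≤ i → μ i = 0 := by
  refine ⟨μ.support.sup id + 1, fun i hi => ?_⟩
  by_contra h
  have := Finset.le_sup (f := id) (Finsupp.mem_support_iff.2 h)
  simp only [id] at this
  omega

theorem Tab.ribbon_subset (T : Tab k lam μ) {i : ℕ} {R : Finset Cell} (hR : R ∈ T.ribbons i) :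
    R ⊆ lam.cells := by
  intro c hc
  have h1 : c ∈ (T.ribbons i).biUnion id := Finset.mem_biUnion.2 ⟨R, hR, hc⟩
  rw [(T.strip i).cover, Finset.mem_sdiff] at h1
  exact YoungDiagram.cells_subset_iff.2 (T.chain_le (i + 1)) h1.1

instance : Finite (Tab k lam μ) := by
  obtain ⟨N, hN⟩ := exists_bound μ
  let f : Tab k lam μ → (Fin N → {s // s ∈ lam.cells.powerset}) ×
      (Fin N → {P // P ∈ lam.cells.powerset.powerset}) := fun T =>
    (fun i => ⟨(T.chain i).cells,
        Finset.mem_powerset.2 (YoungDiagram.cells_subset_iff.2 (T.chain_le i))⟩,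
      fun i => ⟨T.ribbons i, Finset.mem_powerset.2 fun _ hR =>
        Finset.mem_powerset.2 (T.ribbon_subset hR)⟩)
  refine Finite.of_injective f fun T T' h => ?_
  ext1
  · funext i
    by_cases hi : i < N
    · have := congrFun (congrArg Prod.fst h) ⟨i, hi⟩
      exact YoungDiagram.ext (congrArg Subtype.val this)
    · rw [T.chain_eq hN (not_lt.1 hi), T'.chain_eq hN (not_lt.1 hi)]
  · funext i
    by_cases hi : i < N
    · have := congrFun (congrArg Prod.snd h) ⟨i, hi⟩
      exact congrArg Subtype.val this
    · rw [T.ribbons_eq_empty (hN i (not_lt.1 hi)), T'.ribbons_eq_empty (hN i (not_lt.1 hi))]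

theorem Tab.nonempty_ribbon (T : Tab k lam μ) {i : ℕ} {R : Finset Cell} (hR : R ∈ T.ribbons i) :
    1 ≤ height R := by
  obtain ⟨a, ha, -⟩ := (T.strip i).initial R hR
  exact Finset.card_pos.2 ⟨a.1, Finset.mem_image_of_mem _ ha.1⟩

/-- Twice the spin is the natural number `∑ (h(R) - 1)`. -/
theorem Tab.spin_eq (T : Tab k lam μ) :
    T.spin = ((∑ i ∈ μ.support, ∑ R ∈ T.ribbons i, (height R - 1) : ℕ) : ℚ) / 2 := by
  rw [Tab.spin, Nat.cast_sum, Finset.sum_div]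
  refine Finset.sum_congr rfl fun i _ => ?_
  rw [Nat.cast_sum, Finset.sum_div]
  refine Finset.sum_congr rfl fun R hR => ?_
  rw [ribbonSpin, Nat.cast_sub (T.nonempty_ribbon hR), Nat.cast_one]

theorem Tab.twice_spin_le (T : Tab k lam μ) :
    ∑ i ∈ μ.support, ∑ R ∈ T.ribbons i, (height R - 1) ≤ lam.card := by
  have step : ∀ i, ∑ R ∈ T.ribbons i, (height R - 1) + (T.chain i).card ≤
      (T.chain (i + 1)).card := by
    intro i
    have h1 : ∑ R ∈ T.ribbons i, (height R - 1) ≤ ∑ R ∈ T.ribbons i, (id R).card :=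
      Finset.sum_le_sum fun R _ => (Nat.sub_le _ _).trans Finset.card_image_le
    rw [← Finset.card_biUnion (T.strip i).disjoint, (T.strip i).cover] at h1
    have h2 := Finset.card_sdiff_add_card_eq_card
      (YoungDiagram.cells_subset_iff.2 (T.strip i).le)
    simp only [YoungDiagram.card] at *
    omega
  have tel : ∀ n, ∑ i ∈ Finset.range n, ∑ R ∈ T.ribbons i, (height R - 1) ≤ (T.chain n).card := by
    intro n
    induction n with
    | zero => simp
    | succ n ih =>
      rw [Finset.sum_range_succ]
      have := step n
      omega
  obtain ⟨N, hN⟩ := exists_bound μ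
  calc _ ≤ ∑ i ∈ Finset.range N, ∑ R ∈ T.ribbons i, (height R - 1) := by
        refine Finset.sum_le_sum_of_subset fun i hi => ?_
        rw [Finset.mem_range]
        by_contra h
        exact (Finsupp.mem_support_iff.1 hi) (hN i (not_lt.1 h))
    _ ≤ (T.chain N).card := tel N
    _ = lam.card := by rw [T.chain_eq hN le_rfl]

/-- If there are ribbon tableaux of shape `lam` at all, `maxSpin` is the maximum of the spins. -/
theorem isGreatest_maxSpin (h : (spins k lam).Nonempty) :
    IsGreatest (spins k lam) (maxSpin k lam) := by
  have hb : BddAbove {m : ℕ | (m : ℚ) / 2 ∈ spins k lam} := by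
    refine ⟨lam.card, ?_⟩
    rintro m ⟨μ, T, hT⟩
    rw [T.spin_eq] at hT
    have h1 := (div_left_inj' (two_ne_zero (α := ℚ))).1 hT
    rw [← Nat.cast_injective h1]
    exact T.twice_spin_le
  have hne : {m : ℕ | (m : ℚ) / 2 ∈ spins k lam}.Nonempty := by
    obtain ⟨_, μ, T, rfl⟩ := h
    exact ⟨_, μ, T, T.spin_eq⟩
  refine ⟨Nat.sSup_mem hne hb, ?_⟩
  rintro _ ⟨μ, T, rfl⟩
  have h1 := le_csSup hb (show _ ∈ {m : ℕ | (m : ℚ) / 2 ∈ spins k lam} from ⟨μ, T, T.spin_eq⟩)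
  rw [T.spin_eq, maxSpin]
  exact div_le_div_of_nonneg_right (Nat.cast_le.2 h1) zero_le_two

end Finiteness

/-- The coefficient ring: finite `ℤ`-linear combinations of powers `q ^ a` with exponents `a ∈ ℚ`
(so that half-integral spins and their differences make sense as exponents). -/
abbrev QRing := AddMonoidAlgebra ℤ ℚ

/-- The power `q ^ a`. -/
noncomputable def qpow (a : ℚ) : QRing := AddMonoidAlgebra.single a 1

/-- `G̃_lam^{(k)}(X; q) = ∑ q ^ cospin(T) x ^ T`, over all `k`-ribbon tableaux `T` of shape `lam`,
as a formal power series in `x₀, x₁, …`; the sum that gives each coefficient is finite. -/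
noncomputable def Gtilde (k : ℕ) (lam : YoungDiagram) : MvPowerSeries ℕ QRing :=
  fun μ => ∑ᶠ T : Tab k lam μ, qpow T.cospin

/-- `H̃_μ^{(k)}(X; q) = ∑ q ^ cospin(T) x ^ T`, over `k`-ribbon tableaux of shape `kμ`. -/
noncomputable def Htilde (k : ℕ) (μ : YoungDiagram) : MvPowerSeries ℕ QRing :=
  Gtilde k (stretch k μ)

/-- `H_μ^{(k)}(X; q) = ∑ q ^ spin(T) x ^ T`, over `k`-ribbon tableaux of shape `kμ`. -/
noncomputable def Hfun (k : ℕ) (μ : YoungDiagram) : MvPowerSeries ℕ QRing :=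
  fun w => ∑ᶠ T : Tab k (stretch k μ) w, qpow T.spin

/-- A symmetric function: a formal power series of bounded degree that is invariant under all
permutations of the variables. -/
def IsSymmetricFunction {R : Type*} [CommRing R] (f : MvPowerSeries ℕ R) : Prop :=
  (∃ D : ℕ, ∀ d : ℕ →₀ ℕ, MvPowerSeries.coeff d f ≠ 0 → d.degree ≤ D) ∧
    ∀ σ : Equiv.Perm ℕ, MvPowerSeries.renameEquiv R σ f = f

end RibbonTableaux

open RibbonTableaux

/-! Read a partition through its boundary word, a 0/1 sequence indexed by contents whose ones are
beads. Adding a `k`-ribbon with contents `p + 1, …, p + k` moves a bead from `p` to the free site `p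
+ k`, and `h(R) - 1` is the number of beads jumped over (`AddRibbon.height_eq`). A horizontal ribbon
strip is a set of such jumps made from left to right, so it amounts to a finite set of contents
subject to local conditions (`Strip`, `IsHorizontalStripTiling.exists_strip`).

For symmetry it suffices to exchange two adjacent entries of the weight, hence to study two
consecutive strips between fixed partitions. These are the configurations of a two-row vertex model:
a site is a content, and the `k` legs between sites record the beads in flight. A triangular
intertwiner on the legs satisfies a Yang–Baxter relation with one vertex
(`sum_vertexWeight_mul_snocFactor`). Pushing it through all sites interchanges the weights of the
rows, and it is trivial on empty boundary legs (`partitionFunction_comm`). With indeterminate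
weights, comparing coefficients gives a bijection of pairs of strips that swaps the numbers of
ribbons and keeps the total spin (`TwoStep.exists_equiv`). Applied inside tableaux, it gives
invariance under adjacent transpositions, and these suffice because a weight has finite support.

For integrality, count modulo 2 the pairs of beads whose order disagrees with the order of their
residues modulo `k`. A jump changes this parity by the number of beads jumped over
(`AddRibbon.parity_eq`), so twice the spin modulo 2 depends on the shape only, and cospins are
integers. The shape `kμ` is built from horizontal ribbons of height one, so its parity is that of
the empty partition (`parity_stretch`), and spins are integers there. -/

namespace RibbonTableaux

/-! ### Diagonal lengths and the boundary word of a partition -/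

/-- The content of a cell. -/
def content (c : Cell) : ℤ := (c.2 : ℤ) - c.1

/-- The `r`-th cell on the diagonal of content `d`. -/
def diagCell (d : ℤ) (r : ℕ) : Cell := (r + (-d).toNat, r + d.toNat)

theorem diagCell_content (c : Cell) : diagCell (content c) (min c.1 c.2) = c := by
  obtain ⟨i, j⟩ := c
  simp only [diagCell, content, Prod.mk.injEq]
  omega

theorem mem_of_le {lam : YoungDiagram} {c c' : Cell} (h1 : c'.1 ≤ c.1) (h2 : c'.2 ≤ c.2)
    (h : c ∈ lam) : c' ∈ lam :=
  lam.isLowerSet (Prod.mk_le_mk.2 ⟨h1, h2⟩ : (c'.1, c'.2) ≤ (c.1, c.2)) h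

theorem exists_diagCell_notMem (lam : YoungDiagram) (d : ℤ) : ∃ r, diagCell d r ∉ lam := by
  by_contra! h
  have hinj : Function.Injective (diagCell d) := fun a b hab => by
    simp only [diagCell, Prod.mk.injEq] at hab
    omega
  exact Set.infinite_of_injective_forall_mem (s := (lam.cells : Set Cell)) hinj
    (fun r => h r) lam.cells.finite_toSet

/-- The number of cells of content `d`. -/
def dlen (lam : YoungDiagram) (d : ℤ) : ℕ := Nat.find (exists_diagCell_notMem lam d)

theorem diagCell_mem {lam : YoungDiagram} {d : ℤ} {r : ℕ} :
    diagCell d r ∈ lam ↔ r < dlen lam d := by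
  rw [dlen, Nat.lt_find_iff]
  refine ⟨fun h m hm => not_not.2 (mem_of_le ?_ ?_ h), fun h => not_not.1 (h r le_rfl)⟩ <;>
    simp only [diagCell] <;> omega

theorem mem_iff_dlen {lam : YoungDiagram} {c : Cell} :
    c ∈ lam ↔ min c.1 c.2 < dlen lam (content c) := by
  rw [← diagCell_mem, diagCell_content]

theorem mem_iff_row {lam : YoungDiagram} {c : Cell} :
    c ∈ lam ↔ c.1 < dlen lam (content c) + (-content c).toNat := by
  rw [mem_iff_dlen, content]
  omega

theorem le_iff_dlen {α β : YoungDiagram} : α ≤ β ↔ ∀ d, dlen α d ≤ dlen β d := by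
  constructor
  · intro h d
    by_contra! hd
    exact lt_irrefl _ (diagCell_mem.1 (h (diagCell_mem.2 hd)))
  · intro h c hc
    exact mem_iff_dlen.2 ((mem_iff_dlen.1 hc).trans_le (h _))

theorem eq_of_dlen {α β : YoungDiagram} (h : ∀ d, dlen α d = dlen β d) : α = β :=
  le_antisymm (le_iff_dlen.2 fun d => (h d).le) (le_iff_dlen.2 fun d => (h d).ge)

theorem dlen_eq_of_forall {lam : YoungDiagram} {d : ℤ} {n : ℕ}
    (h : ∀ r, diagCell d r ∈ lam ↔ r < n) : dlen lam d = n := by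
  have h1 := (h n).symm.trans diagCell_mem
  have h2 := (h (dlen lam d)).symm.trans diagCell_mem
  omega

/-- The bit of the boundary path between the diagonals `d` and `d + 1`: it is `1` at vertical
steps and `0` at horizontal ones. -/
def bit (lam : YoungDiagram) (d : ℤ) : ℤ :=
  (dlen lam d : ℤ) - dlen lam (d + 1) + if d < 0 then 1 else 0

/-- The left neighbour of the `r`-th cell of diagonal `d + 1` has index `r` on diagonal `d` if `0 ≤
d`, and `r - 1` if `d < 0`; the correction term in `bit` is this shift. -/
theorem bit_nonneg (lam : YoungDiagram) (d : ℤ) : 0 ≤ bit lam d := by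
  rw [bit]
  by_contra! h
  split_ifs at h with hd
  · have h1 : diagCell (d + 1) (dlen lam d + 1) ∈ lam := diagCell_mem.2 (by omega)
    have h2 : diagCell d (dlen lam d) ∈ lam :=
      mem_of_le (by simp only [diagCell]; omega) (by simp only [diagCell]; omega) h1
    exact lt_irrefl _ (diagCell_mem.1 h2)
  · have h1 : diagCell (d + 1) (dlen lam d) ∈ lam := diagCell_mem.2 (by omega)
    have h2 : diagCell d (dlen lam d) ∈ lam :=
      mem_of_le (by simp only [diagCell]; omega) (by simp only [diagCell]; omega) h1
    exact lt_irrefl _ (diagCell_mem.1 h2)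

theorem bit_le_one (lam : YoungDiagram) (d : ℤ) : bit lam d ≤ 1 := by
  rw [bit]
  by_contra! h
  split_ifs at h with hd
  · have h1 : diagCell d (dlen lam (d + 1)) ∈ lam := diagCell_mem.2 (by omega)
    have h2 : diagCell (d + 1) (dlen lam (d + 1)) ∈ lam :=
      mem_of_le (by simp only [diagCell]; omega) (by simp only [diagCell]; omega) h1
    exact lt_irrefl _ (diagCell_mem.1 h2)
  · have h1 : diagCell d (dlen lam (d + 1) + 1) ∈ lam := diagCell_mem.2 (by omega)
    have h2 : diagCell (d + 1) (dlen lam (d + 1)) ∈ lam :=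
      mem_of_le (by simp only [diagCell]; omega) (by simp only [diagCell]; omega) h1
    exact lt_irrefl _ (diagCell_mem.1 h2)

/-- Far away diagonals are empty. -/
theorem exists_dlen_eq_zero (lam : YoungDiagram) :
    ∃ M : ℕ, ∀ d : ℤ, (d ≤ -M ∨ M ≤ d) → dlen lam d = 0 := by
  refine ⟨lam.cells.sup (fun c => c.1 + c.2) + 1, fun d hd => ?_⟩
  by_contra h
  have h1 : diagCell d 0 ∈ lam := diagCell_mem.2 (Nat.pos_of_ne_zero h)
  have h2 : 0 + (-d).toNat + (0 + d.toNat) ≤ lam.cells.sup (fun c => c.1 + c.2) :=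
    Finset.le_sup (f := fun c : Cell => c.1 + c.2) ((YoungDiagram.mem_cells _).2 h1)
  push_cast at hd
  omega

/-- A function with finite support whose boundary bits are `0` or `1` consists of the diagonal
lengths of a partition. -/
theorem exists_dlen_eq (n : ℤ → ℕ) (M : ℕ) (hM : ∀ d : ℤ, (d ≤ -M ∨ M ≤ d) → n d = 0)
    (h0 : ∀ d, 0 ≤ (n d : ℤ) - n (d + 1) + if d < 0 then 1 else 0)
    (h1 : ∀ d, (n d : ℤ) - n (d + 1) + (if d < 0 then 1 else 0) ≤ 1) :
    ∃ lam, ∀ d, dlen lam d = n d := by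
  have hstep1 : ∀ i j : ℕ, min (i + 1) j < n (j - (i + 1 : ℕ)) → min i j < n (j - i) := by
    intro i j h
    have a0 := h0 (j - (i + 1 : ℕ))
    have a1 := h1 (j - (i + 1 : ℕ))
    rw [show (j : ℤ) - (i + 1 : ℕ) + 1 = j - i by push_cast; ring] at a0 a1
    split_ifs at a0 a1 <;> omega
  have hstep2 : ∀ i j : ℕ, min i (j + 1) < n ((j + 1 : ℕ) - i) → min i j < n (j - i) := by
    intro i j h
    have a0 := h0 (j - i)
    have a1 := h1 (j - i)
    rw [show (j : ℤ) - i + 1 = (j + 1 : ℕ) - i by push_cast; ring] at a0 a1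
    split_ifs at a0 a1 <;> omega
  have hlow1 : ∀ m i j : ℕ, min (i + m) j < n (j - (i + m : ℕ)) → min i j < n (j - i) := by
    intro m
    induction m with
    | zero => intro i j h; exact h
    | succ m ih => intro i j h; exact ih i j (hstep1 _ _ h)
  have hlow2 : ∀ m i j : ℕ, min i (j + m) < n ((j + m : ℕ) - i) → min i j < n (j - i) := by
    intro m
    induction m with
    | zero => intro i j h; exact h
    | succ m ih => intro i j h; exact ih i j (hstep2 _ _ h)
  -- The smaller coordinate of a cell is below the supremum of `n`, and the two coordinates differ
  -- by less than `M`.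
  let K := (Finset.Ico (-M : ℤ) M).sup n + M + 1
  have hK : ∀ i j : ℕ, min i j < n (j - i) → i < K ∧ j < K := by
    intro i j h
    have hd : -(M : ℤ) < j - i ∧ (j - i : ℤ) < M := by
      constructor <;> by_contra! hc
      · rw [hM _ (Or.inl hc)] at h; omega
      · rw [hM _ (Or.inr hc)] at h; omega
    have := Finset.le_sup (f := n) (Finset.mem_Ico.2 ⟨hd.1.le, hd.2⟩)
    simp only [K]
    omega
  let lam : YoungDiagram :=
    { cells := (Finset.range K ×ˢ Finset.range K).filter fun c => min c.1 c.2 < n (c.2 - c.1)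
      isLowerSet := by
        rintro ⟨i, j⟩ ⟨i', j'⟩ h hc
        obtain ⟨e1, e2⟩ := Prod.mk_le_mk.1 h
        simp only [Finset.coe_filter, Finset.mem_product, Finset.mem_range,
          Set.mem_ofPred_eq] at hc ⊢
        obtain ⟨m, rfl⟩ := Nat.exists_eq_add_of_le e1
        obtain ⟨m', rfl⟩ := Nat.exists_eq_add_of_le e2
        exact ⟨by omega, hlow2 m' _ _ (hlow1 m _ _ hc.2)⟩ }
  have hmem : ∀ c : Cell, c ∈ lam ↔ min c.1 c.2 < n (c.2 - c.1) := by
    intro c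
    rw [← YoungDiagram.mem_cells]
    simp only [lam, Finset.mem_filter, Finset.mem_product, Finset.mem_range]
    exact ⟨fun h => h.2, fun h => ⟨hK _ _ h, h⟩⟩
  refine ⟨lam, fun d => dlen_eq_of_forall fun r => ?_⟩
  rw [hmem]
  simp only [diagCell]
  rw [show (((r + d.toNat : ℕ) : ℤ) - (r + (-d).toNat : ℕ)) = d by omega]
  omega

/-! ### Ribbons parametrised by content -/

/-- `R` is a ribbon with contents `p + 1, …, p + k` whose cell of content `d` lies in row `ρ d`. -/
structure IsRibbonAt (k : ℕ) (p : ℤ) (ρ : ℤ → ℕ) (R : Finset Cell) : Prop where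
  nonneg : ∀ d, p < d → d ≤ p + k → 0 ≤ ρ d + d
  mem : ∀ c : Cell, c ∈ R ↔ p < content c ∧ content c ≤ p + k ∧ c.1 = ρ (content c)
  step : ∀ d, p < d → d < p + k → ρ d = ρ (d + 1) ∨ ρ d = ρ (d + 1) + 1

/-- The content drops by one at each step of the path, so the ribbon has one cell on each of `k`
consecutive diagonals; the path starts at the largest content `p + k`. -/
theorem IsRibbon.exists_isRibbonAt {k : ℕ} {R : Finset Cell} (h : IsRibbon k R) :
    ∃ p ρ, IsRibbonAt k p ρ R := by
  obtain ⟨c, rfl, hc⟩ := h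
  have hcont : ∀ i, i < k → content (c i) = content (c 0) - i := by
    intro i
    induction i with
    | zero => simp
    | succ i ih =>
      intro hi
      have h1 := ih (by omega)
      rcases hc i hi with h | h
      · rw [h]
        simp only [content] at h1 ⊢
        push_cast
        omega
      · rw [h] at h1
        simp only [content] at h1 ⊢
        push_cast at h1 ⊢
        omega
  refine ⟨content (c 0) - k, fun d => (c (content (c 0) - d).toNat).1, ?_, ?_, ?_⟩
  · intro d h1 h2
    have := hcont (content (c 0) - d).toNat (by omega)
    simp only [content] at this ⊢
    omega
  · intro b
    simp only [Finset.mem_image, Finset.mem_range]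
    constructor
    · rintro ⟨i, hi, rfl⟩
      rw [hcont i hi]
      refine ⟨by omega, by omega, ?_⟩
      rw [show (content (c 0) - (content (c 0) - (i : ℤ))).toNat = i by omega]
    · rintro ⟨h1, h2, h3⟩
      refine ⟨(content (c 0) - content b).toNat, by omega, ?_⟩
      have := hcont (content (c 0) - content b).toNat (by omega)
      rw [Prod.ext_iff]
      refine ⟨h3.symm, ?_⟩
      generalize c (content (c 0) - content b).toNat = e at *
      have h4 : content e = content b := by omega
      simp only [content] at h4
      omega
  · intro d h1 h2
    have := hc (content (c 0) - (d + 1)).toNat (by omega)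
    rw [show (content (c 0) - (d + 1)).toNat + 1 = (content (c 0) - d).toNat by omega] at this
    rcases this with h | h
    · right; rw [h]
    · left; rw [h]

theorem IsRibbonAt.isRibbon {k : ℕ} {p : ℤ} {ρ : ℤ → ℕ} {R : Finset Cell}
    (h : IsRibbonAt k p ρ R) : IsRibbon k R := by
  refine ⟨fun i => (ρ (p + k - i), (ρ (p + k - i) + (p + k - i)).toNat), ?_, ?_⟩
  · ext c
    rw [h.mem]
    simp only [Finset.mem_image, Finset.mem_range]
    constructor
    · rintro ⟨h1, h2, h3⟩
      refine ⟨(p + k - content c).toNat, by omega, ?_⟩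
      rw [show p + k - ((p + k - content c).toNat : ℤ) = content c by omega, ← h3]
      ext
      · rfl
      · simp only [content]; omega
    · rintro ⟨i, hi, rfl⟩
      have := h.nonneg (p + k - i) (by omega) (by omega)
      have h2 : content (ρ (p + k - i), (ρ (p + k - i) + (p + k - i)).toNat) = p + k - i := by
        simp only [content]; omega
      rw [h2]
      exact ⟨by omega, by omega, rfl⟩
  · intro i hi
    have h1 := h.step (p + k - (i + 1 : ℕ)) (by omega) (by push_cast; omega)
    have h2 := h.nonneg (p + k - (i + 1 : ℕ)) (by omega) (by push_cast; omega)
    have h3 := h.nonneg (p + k - i) (by omega) (by omega)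
    rw [show p + k - ((i + 1 : ℕ) : ℤ) + 1 = p + k - i by push_cast; ring] at h1
    simp only [Prod.mk.injEq]
    push_cast at *
    omega

theorem IsRibbonAt.antitone {k : ℕ} {p : ℤ} {ρ : ℤ → ℕ} {R : Finset Cell}
    (h : IsRibbonAt k p ρ R) (m : ℕ) (d : ℤ) (h1 : p < d) (h2 : d + m ≤ p + k) :
    ρ (d + m) ≤ ρ d := by
  induction m with
  | zero => simp
  | succ m ih =>
    have a := ih (by push_cast at h2; omega)
    have b := h.step (d + m) (by omega) (by push_cast at h2; omega)
    rw [show d + ((m + 1 : ℕ) : ℤ) = d + m + 1 by push_cast; ring]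
    omega

/-- Along increasing content rows weakly decrease and columns weakly increase, so the extreme cell
is the one of largest content. -/
theorem IsRibbonAt.isInitialCell_iff {k : ℕ} {p : ℤ} {ρ : ℤ → ℕ} {R : Finset Cell}
    (h : IsRibbonAt k p ρ R) (hk : 1 ≤ k) {a : Cell} :
    IsInitialCell a R ↔ content a = p + k ∧ a.1 = ρ (p + k) := by
  constructor
  · rintro ⟨h1, h2⟩
    have h3 := h.nonneg (p + k) (by omega) le_rfl
    have h4 : content (ρ (p + k), (ρ (p + k) + (p + k)).toNat) = p + k := by
      simp only [content]; omega
    have h5 := h2 (ρ (p + k), (ρ (p + k) + (p + k)).toNat)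
      ((h.mem _).2 ⟨by omega, by omega, by rw [h4]⟩)
    obtain ⟨e1, e2, e3⟩ := (h.mem a).1 h1
    have h6 : content a = p + k := by
      simp only [content] at *
      omega
    exact ⟨h6, by rw [e3, h6]⟩
  · rintro ⟨h1, h2⟩
    refine ⟨(h.mem a).2 ⟨by omega, by omega, by rw [h1, h2]⟩, fun b hb => ?_⟩
    obtain ⟨e1, e2, e3⟩ := (h.mem b).1 hb
    have h3 := h.antitone (p + k - content b).toNat (content b) e1 (by omega)
    rw [show content b + ((p + k - content b).toNat : ℤ) = p + k by omega] at h3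
    have h4 : a.1 ≤ b.1 := by omega
    refine ⟨h4, ?_⟩
    by_contra! h5
    -- columns weakly decrease along the ribbon
    have hcol : ∀ m : ℕ, ∀ d : ℤ, p < d → d + m ≤ p + k →
        (ρ d : ℤ) + d ≤ ρ (d + m) + (d + m) := by
      intro m d hd hm
      induction m with
      | zero => simp
      | succ m ih =>
        have a := ih (by push_cast at hm; omega)
        have b := h.step (d + m) (by omega) (by push_cast at hm; omega)
        rw [show d + ((m + 1 : ℕ) : ℤ) = d + m + 1 by push_cast; ring]
        omega
    have h7 := hcol (p + k - content b).toNat (content b) e1 (by omega)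
    rw [show content b + ((p + k - content b).toNat : ℤ) = p + k by omega] at h7
    simp only [content] at *
    omega

/-- Rows change by at most one between consecutive contents, so no row between the extreme ones is
skipped. -/
theorem IsRibbonAt.height_eq {k : ℕ} {p : ℤ} {ρ : ℤ → ℕ} {R : Finset Cell}
    (h : IsRibbonAt k p ρ R) (hk : 1 ≤ k) : height R = ρ (p + 1) - ρ (p + k) + 1 := by
  have hmono := h.antitone (k - 1) (p + 1) (by omega) (by omega)
  rw [show p + 1 + ((k - 1 : ℕ) : ℤ) = p + k by omega] at hmono
  have himg : R.image Prod.fst = Finset.Icc (ρ (p + k)) (ρ (p + 1)) := by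
    ext r
    simp only [Finset.mem_image, Finset.mem_Icc]
    constructor
    · rintro ⟨c, hc, rfl⟩
      obtain ⟨e1, e2, e3⟩ := (h.mem c).1 hc
      have h1 := h.antitone (p + k - content c).toNat (content c) e1 (by omega)
      have h2 := h.antitone (content c - (p + 1)).toNat (p + 1) (by omega) (by omega)
      rw [show content c + ((p + k - content c).toNat : ℤ) = p + k by omega] at h1
      rw [show p + 1 + ((content c - (p + 1)).toNat : ℤ) = content c by omega] at h2
      omega
    · rintro ⟨h1, h2⟩
      have key : ∀ m : ℕ, m < k → ρ (p + 1 + m) ≤ r → ∃ d, p < d ∧ d ≤ p + k ∧ ρ d = r := by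
        intro m
        induction m with
        | zero => intro hm hr; exact ⟨p + 1, by omega, by omega, by simp at hr; omega⟩
        | succ m ih =>
          intro hm hr
          have hs := h.step (p + 1 + m) (by omega) (by omega)
          rw [show p + 1 + ((m + 1 : ℕ) : ℤ) = p + 1 + m + 1 by push_cast; ring] at hr
          by_cases hh : ρ (p + 1 + m) ≤ r
          · exact ih (by omega) hh
          · exact ⟨p + 1 + m + 1, by omega, by omega, by omega⟩
      obtain ⟨d, d1, d2, d3⟩ := key (k - 1) (by omega) (by
        rw [show p + 1 + ((k - 1 : ℕ) : ℤ) = p + k by omega]; exact h1)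
      have hn := h.nonneg d d1 d2
      have hcd : content (ρ d, (ρ d + d).toNat) = d := by simp only [content]; omega
      exact ⟨(ρ d, (ρ d + d).toNat), (h.mem _).2 (by rw [hcd]; exact ⟨d1, d2, rfl⟩), d3⟩
  rw [height, himg, Nat.card_Icc]
  omega

/-! ### Adding a ribbon as a bead jump -/

/-- `β` arises from `α` by adding a ribbon with contents `p + 1, …, p + k`. -/
def AddRibbon (k : ℕ) (p : ℤ) (α β : YoungDiagram) : Prop :=
  ∀ d, dlen β d = dlen α d + if p < d ∧ d ≤ p + k then 1 else 0

theorem AddRibbon.le {k : ℕ} {p : ℤ} {α β : YoungDiagram} (h : AddRibbon k p α β) : α ≤ β :=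
  le_iff_dlen.2 fun d => by rw [h d]; omega

/-- The cell added on diagonal `d` has index `dlen α d`, which gives its row; that the bits of `α`
are `0` or `1` is exactly the step condition. -/
theorem AddRibbon.isRibbonAt {k : ℕ} {p : ℤ} {α β : YoungDiagram} (h : AddRibbon k p α β) :
    IsRibbonAt k p (fun d => dlen α d + (-d).toNat) (β.cells \ α.cells) where
  nonneg d _ _ := by push_cast; omega
  mem c := by
    rw [Finset.mem_sdiff, YoungDiagram.mem_cells, YoungDiagram.mem_cells, mem_iff_row,
      mem_iff_row, h]
    split_ifs <;> omega
  step d _ _ := by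
    have h0 := bit_nonneg α d
    have h1 := bit_le_one α d
    simp only [bit] at h0 h1
    split_ifs at h0 h1 <;> omega

/-- The new cells on a diagonal have consecutive indices from `dlen α d` on, and a ribbon has at
most one cell there. -/
theorem AddRibbon.of_isRibbonAt {k : ℕ} {p : ℤ} {ρ : ℤ → ℕ} {α β : YoungDiagram} (hle : α ≤ β)
    (h : IsRibbonAt k p ρ (β.cells \ α.cells)) : AddRibbon k p α β := by
  intro d
  have hle' := le_iff_dlen.1 hle d
  have key : ∀ r, (r < dlen β d ∧ ¬ r < dlen α d) ↔
      (p < d ∧ d ≤ p + k ∧ r + (-d).toNat = ρ d) := by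
    intro r
    have h1 := h.mem (diagCell d r)
    have hc : content (diagCell d r) = d := by simp only [content, diagCell]; omega
    rw [hc, Finset.mem_sdiff, YoungDiagram.mem_cells, YoungDiagram.mem_cells, diagCell_mem,
      diagCell_mem] at h1
    exact h1
  split_ifs with hd
  · have h1 := h.nonneg d hd.1 hd.2
    have h2 := (key (ρ d - (-d).toNat)).2 ⟨hd.1, hd.2, by omega⟩
    have h3 := key (dlen α d)
    have h4 := key (dlen β d - 1)
    omega
  · have h3 := key (dlen α d)
    by_contra hne
    exact hd ⟨(h3.1 (by omega)).1, (h3.1 (by omega)).2.1⟩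

/-- Neighbouring diagonals grow by different amounts only at the two ends of the interval of
contents. -/
theorem AddRibbon.bit_eq {k : ℕ} {p : ℤ} {α β : YoungDiagram} (h : AddRibbon k p α β)
    (hk : 1 ≤ k) (d : ℤ) :
    bit β d = bit α d + (if d = p + k then 1 else 0) - if d = p then 1 else 0 := by
  simp only [bit, h d, h (d + 1)]
  push_cast
  split_ifs <;> omega

/-- The height of an added ribbon is one more than the number of beads that are jumped over. -/
theorem AddRibbon.height_eq {k : ℕ} {p : ℤ} {α β : YoungDiagram} (h : AddRibbon k p α β)
    (hk : 1 ≤ k) :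
    ((height (β.cells \ α.cells) - 1 : ℕ) : ℤ) = ∑ d ∈ Finset.Ioo p (p + k), bit α d := by
  rw [h.isRibbonAt.height_eq hk]
  have hmono := h.isRibbonAt.antitone (k - 1) (p + 1) (by omega) (by omega)
  rw [show p + 1 + ((k - 1 : ℕ) : ℤ) = p + k by omega] at hmono
  -- The bit at `d` is the row of the added cell of content `d` minus that of content `d + 1`, so
  -- the sum telescopes.
  have key : ∀ m : ℕ, ∑ d ∈ Finset.Ioo p (p + 1 + m), bit α d =
      (dlen α (p + 1) + (-(p + 1)).toNat : ℕ) - (dlen α (p + 1 + m) + (-(p + 1 + m)).toNat : ℕ) := by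
    intro m
    induction m with
    | zero =>
      rw [Finset.sum_eq_zero]
      · simp
      · intro d hd
        rw [Finset.mem_Ioo] at hd
        push_cast at hd
        omega
    | succ m ih =>
      have : Finset.Ioo p (p + 1 + (m + 1 : ℕ)) = insert (p + 1 + m) (Finset.Ioo p (p + 1 + m)) := by
        ext d
        simp only [Finset.mem_Ioo, Finset.mem_insert]
        push_cast
        omega
      rw [this, Finset.sum_insert (by simp), ih, bit]
      rw [show p + 1 + ((m + 1 : ℕ) : ℤ) = p + 1 + m + 1 by push_cast; ring]
      push_cast
      split_ifs <;> omega
  have := key (k - 1)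
  rw [show p + 1 + ((k - 1 : ℕ) : ℤ) = p + k by omega] at this
  rw [this]
  omega

/-- A bead can jump by `k` whenever the target is free. -/
theorem exists_addRibbon {k : ℕ} (hk : 1 ≤ k) {p : ℤ} {α : YoungDiagram} (h1 : bit α p = 1)
    (h0 : bit α (p + k) = 0) : ∃ β, AddRibbon k p α β := by
  obtain ⟨M, hM⟩ := exists_dlen_eq_zero α
  refine exists_dlen_eq (fun d => dlen α d + if p < d ∧ d ≤ p + k then 1 else 0)
    (M + p.natAbs + k + 1) ?_ ?_ ?_
  · intro d hd
    rw [hM d (by omega), if_neg (by omega)]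
  -- Only two bits change: the one at `p` drops to `0` and the one at `p + k` rises to `1`.
  all_goals
    intro d
    have a0 := bit_nonneg α d
    have a1 := bit_le_one α d
    by_cases e1 : d = p
    · subst e1
      simp only [bit] at *
      push_cast
      split_ifs at * <;> omega
    by_cases e2 : d = p + k
    · subst e2
      simp only [bit] at *
      push_cast
      split_ifs at * <;> omega
    simp only [bit] at a0 a1
    push_cast
    split_ifs at * <;> omega

/-! ### Strips as sets of bead jumps -/

/-- `β` arises from `α` by adding the ribbons in `P`, with contents `p + 1, …, p + k` for `p ∈ S`,
in increasing order of `p`. -/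
inductive Strip (k : ℕ) (α : YoungDiagram) :
    YoungDiagram → Finset ℤ → Finset (Finset Cell) → Prop
  | nil : Strip k α α ∅ ∅
  | snoc {β γ : YoungDiagram} {S : Finset ℤ} {P : Finset (Finset Cell)} {p : ℤ} :
    Strip k α β S P → (∀ p' ∈ S, p' < p) → AddRibbon k p β γ →
      Strip k α γ (insert p S) (insert (γ.cells \ β.cells) P)

namespace Strip

variable {k : ℕ} {α β : YoungDiagram} {S : Finset ℤ} {P : Finset (Finset Cell)}

theorem dlen_eq (h : Strip k α β S P) (d : ℤ) :
    dlen β d = dlen α d + (S.filter fun p => p < d ∧ d ≤ p + k).card := by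
  induction h with
  | nil => simp
  | @snoc β γ S P p _ hp ha ih =>
    have hn : p ∉ S := fun h => lt_irrefl _ (hp p h)
    rw [ha d, ih, Finset.filter_insert]
    split_ifs with hd
    · rw [Finset.card_insert_of_notMem (by simp [hn]), add_assoc]
    · rfl

theorem le (h : Strip k α β S P) : α ≤ β :=
  le_iff_dlen.2 fun d => by rw [h.dlen_eq d]; omega

theorem bit_eq (h : Strip k α β S P) (hk : 1 ≤ k) (d : ℤ) :
    bit β d = bit α d + (if d - k ∈ S then 1 else 0) - if d ∈ S then 1 else 0 := by
  induction h with
  | nil => simp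
  | @snoc β γ S P p _ hp ha ih =>
    have hn : p ∉ S := fun h => lt_irrefl _ (hp p h)
    rw [ha.bit_eq hk, ih]
    simp only [Finset.mem_insert]
    by_cases e1 : d = p + k
    · subst e1
      have h1 : p + (k : ℤ) ∉ S := fun h => by have := hp _ h; omega
      have h3 : ¬ (p + (k : ℤ) = p) := by omega
      simp [hn, h1, h3]
    · have h2 : ¬ (d - k = p) := by omega
      by_cases e2 : d = p
      · subst e2
        have h3 : d - (k : ℤ) ≠ d := by omega
        simp [hn, e1, h3]
      · simp [e1, e2, h2]

/-- A bead of `α` on `p + k` could only get away by a jump of larger content, which comes after the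
jump from `p`; so it would block the landing. -/
theorem bit_add_eq_zero (h : Strip k α β S P) (hk : 1 ≤ k) {p : ℤ} (hp : p ∈ S) :
    bit α (p + k) = 0 := by
  induction h with
  | nil => simp at hp
  | @snoc β γ S P q hs hq ha ih =>
    rcases Finset.mem_insert.1 hp with rfl | hp
    · have h1 := ha.bit_eq hk (p + k)
      have h2 := hs.bit_eq hk (p + k)
      have h3 := bit_le_one γ (p + k)
      have h4 := bit_nonneg α (p + k)
      have h5 : p + (k : ℤ) ∉ S := fun h => by have := hq _ h; omega
      have h6 : p ∉ S := fun h => by have := hq _ h; omega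
      have h7 : ¬ (p + (k : ℤ) = p) := by omega
      simp [h7] at h1
      simp [h5, h6] at h2
      omega
    · exact ih hp

/-- The bead that leaves `p` was there from the start or has landed from `p - k`; both at once is
impossible, since a landing needs a free site. -/
theorem bit_add_mem_eq_one (h : Strip k α β S P) (hk : 1 ≤ k) {p : ℤ} (hp : p ∈ S) :
    bit α p + (if p - k ∈ S then 1 else 0) = 1 := by
  have h1 := h.bit_eq hk p
  have h2 := bit_nonneg β p
  rw [if_pos hp] at h1
  have h3 := bit_le_one α p
  split_ifs at h1 ⊢ with h4
  · have h5 := h.bit_add_eq_zero hk h4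
    rw [sub_add_cancel] at h5
    omega
  · omega

theorem subset_cells (h : Strip k α β S P) {R : Finset Cell} (hR : R ∈ P) :
    R ⊆ β.cells \ α.cells := by
  induction h with
  | nil => simp at hR
  | @snoc β γ S P q hs hq ha ih =>
    have h1 := YoungDiagram.cells_subset_iff.2 ha.le
    have h2 := YoungDiagram.cells_subset_iff.2 hs.le
    rcases Finset.mem_insert.1 hR with rfl | hR
    · exact Finset.sdiff_subset_sdiff le_rfl h2
    · exact (ih hR).trans (Finset.sdiff_subset_sdiff h1 le_rfl)

theorem exists_isRibbonAt (h : Strip k α β S P) {p : ℤ} (hp : p ∈ S) :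
    ∃ R ∈ P, ∃ ρ, IsRibbonAt k p ρ R := by
  induction h with
  | nil => simp at hp
  | @snoc β γ S P q hs hq ha ih =>
    rcases Finset.mem_insert.1 hp with rfl | hp
    · exact ⟨_, Finset.mem_insert_self _ _, _, ha.isRibbonAt⟩
    · obtain ⟨R, hR, h⟩ := ih hp
      exact ⟨R, Finset.mem_insert_of_mem hR, h⟩

end Strip

theorem AddRibbon.nonempty {k : ℕ} {p : ℤ} {α β : YoungDiagram} (h : AddRibbon k p α β)
    (hk : 1 ≤ k) : (β.cells \ α.cells).Nonempty := by
  refine ⟨diagCell (p + k) (dlen α (p + k)), ?_⟩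
  rw [Finset.mem_sdiff, YoungDiagram.mem_cells, YoungDiagram.mem_cells, diagCell_mem,
    diagCell_mem, h, if_pos ⟨by omega, by omega⟩]
  omega

namespace Strip

variable {k : ℕ} {α β : YoungDiagram} {S : Finset ℤ} {P : Finset (Finset Cell)}

theorem ribbon_notMem {γ : YoungDiagram} {p : ℤ} (h : Strip k α β S P) (ha : AddRibbon k p β γ)
    (hk : 1 ≤ k) : γ.cells \ β.cells ∉ P := by
  intro hR
  obtain ⟨c, hc⟩ := ha.nonempty hk
  have h1 := h.subset_cells hR hc
  rw [Finset.mem_sdiff] at hc h1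
  exact hc.2 h1.1

theorem card_eq (h : Strip k α β S P) (hk : 1 ≤ k) : P.card = S.card := by
  induction h with
  | nil => rfl
  | @snoc β γ S P q hs hq ha ih =>
    rw [Finset.card_insert_of_notMem (hs.ribbon_notMem ha hk),
      Finset.card_insert_of_notMem (fun h => lt_irrefl _ (hq q h)), ih]

/-- The sum of `h(R) - 1` over the ribbons of a strip in terms of beads. -/
theorem sum_height_eq (h : Strip k α β S P) (hk : 1 ≤ k) :
    ((∑ R ∈ P, (height R - 1) : ℕ) : ℤ) =
      ∑ p ∈ S, ∑ d ∈ Finset.Ioo p (p + k), (bit α d + if d - k ∈ S then 1 else 0) := by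
  induction h with
  | nil => rfl
  | @snoc β γ S P q hs hq ha ih =>
    rw [Finset.sum_insert (hs.ribbon_notMem ha hk),
      Finset.sum_insert (fun h => lt_irrefl _ (hq q h)), Nat.cast_add, ih, ha.height_eq hk]
    congr 1
    -- Earlier jumps start below `q`, so the sites beyond `q` have received beads but lost none when
    -- the bead at `q` jumps.
    · refine Finset.sum_congr rfl fun d hd => ?_
      rw [Finset.mem_Ioo] at hd
      have h1 : d ∉ S := fun h => by have := hq _ h; omega
      have h2 : d - k ≠ q := by omega
      rw [hs.bit_eq hk]
      simp [h1, h2]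
    · refine Finset.sum_congr rfl fun p hp => Finset.sum_congr rfl fun d hd => ?_
      rw [Finset.mem_Ioo] at hd
      have h1 := hq p hp
      have h2 : d - k ≠ q := by omega
      simp [h2]

/-- The end of a strip and its ribbons are determined by the set of contents. -/
theorem unique (h : Strip k α β S P) {β' : YoungDiagram} {P' : Finset (Finset Cell)}
    (h' : Strip k α β' S P') : β = β' ∧ P = P' := by
  induction h generalizing β' P' with
  | nil =>
    generalize hS : (∅ : Finset ℤ) = S' at h'
    cases h' with
    | nil => exact ⟨rfl, rfl⟩
    | snoc => exact absurd hS.symm (Finset.insert_ne_empty _ _)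
  | @snoc β γ S P q hs hq ha ih =>
    generalize hS : insert q S = S' at h'
    cases h' with
    | nil => exact absurd hS (Finset.insert_ne_empty _ _)
    | @snoc β' _ S' P' q' hs' hq' ha' =>
      have e1 : q = q' := by
        have h1 : q ∈ insert q' S' := hS ▸ Finset.mem_insert_self _ _
        have h2 : q' ∈ insert q S := hS ▸ Finset.mem_insert_self _ _
        rcases Finset.mem_insert.1 h1 with h1 | h1
        · exact h1
        rcases Finset.mem_insert.1 h2 with h2 | h2
        · exact h2.symm
        have := hq' _ h1
        have := hq _ h2
        omega
      subst e1
      have e2 : S = S' := by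
        have h1 := congrArg (fun s => s.erase q) hS
        simpa [Finset.erase_insert, show q ∉ S from fun h => lt_irrefl _ (hq q h),
          show q ∉ S' from fun h => lt_irrefl _ (hq' q h)] using h1
      subst e2
      obtain ⟨rfl, rfl⟩ := ih hs'
      obtain rfl := eq_of_dlen (α := γ) fun d => (ha d).trans (ha' d).symm
      exact ⟨rfl, rfl⟩

/-- The set of contents of a strip is determined by its ends. -/
theorem contents_unique (h : Strip k α β S P) {S' : Finset ℤ} {P' : Finset (Finset Cell)}
    (h' : Strip k α β S' P') (hk : 1 ≤ k) : S = S' := by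
  -- By `bit_eq`, the end bits at `d` and membership of `d - k` decide membership of `d`; thus the
  -- set is recovered from left to right.
  have key : ∀ d : ℤ, (d - k ∈ S ↔ d - k ∈ S') → (d ∈ S ↔ d ∈ S') := by
    intro d hd
    have h1 := h.bit_eq hk d
    have h2 := h'.bit_eq hk d
    rw [h1] at h2
    by_cases e : d - k ∈ S
    · simp only [if_pos e, if_pos (hd.1 e)] at h2
      split_ifs at h2 <;> first | omega | tauto
    · simp only [if_neg e, if_neg (fun h => e (hd.2 h))] at h2
      split_ifs at h2 <;> first | omega | tauto
  obtain ⟨m, hm⟩ : ∃ m : ℤ, ∀ d ∈ S ∪ S', m ≤ d := by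
    obtain ⟨m, hm⟩ := (S ∪ S').bddBelow
    exact ⟨m, fun d hd => hm hd⟩
  have hlt : ∀ n : ℕ, ∀ d : ℤ, d < m + n → (d ∈ S ↔ d ∈ S') := by
    intro n
    induction n with
    | zero =>
      intro d hd
      have h1 : d ∉ S := fun h => by have := hm d (Finset.mem_union_left _ h); simp at hd; omega
      have h2 : d ∉ S' := fun h => by have := hm d (Finset.mem_union_right _ h); simp at hd; omega
      simp [h1, h2]
    | succ n ih =>
      intro d hd
      exact key d (ih (d - k) (by push_cast at hd; omega))
  ext d
  exact hlt (d - m + 1).toNat d (by omega)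

/-- A set of contents satisfying the local conditions is the one of a strip. -/
theorem exists_of_bit (hk : 1 ≤ k) (α : YoungDiagram) (S : Finset ℤ)
    (h0 : ∀ p ∈ S, bit α (p + k) = 0)
    (h1 : ∀ p ∈ S, bit α p + (if p - k ∈ S then 1 else 0) = 1) : ∃ β P, Strip k α β S P := by
  induction S using Finset.induction_on_max with
  | empty => exact ⟨α, ∅, nil⟩
  | @insert q S hq ih =>
    have hn : q ∉ S := fun h => lt_irrefl _ (hq q h)
    obtain ⟨β, P, hs⟩ := ih (fun p hp => h0 p (Finset.mem_insert_of_mem hp)) (by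
      intro p hp
      have h2 := h1 p (Finset.mem_insert_of_mem hp)
      have h3 := hq p hp
      have h4 : p - k ≠ q := by omega
      simpa [h4] using h2)
    have hb1 : bit β q = 1 := by
      have h2 := h1 q (Finset.mem_insert_self _ _)
      have h4 : q - k ≠ q := by omega
      simp only [Finset.mem_insert, h4, false_or] at h2
      rw [hs.bit_eq hk, if_neg hn, sub_zero, h2]
    have hb0 : bit β (q + k) = 0 := by
      have h2 := h0 q (Finset.mem_insert_self _ _)
      have h5 : q + (k : ℤ) ∉ S := fun h => by have := hq _ h; omega
      rw [hs.bit_eq hk, h2]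
      simp [hn, h5]
    obtain ⟨γ, hγ⟩ := exists_addRibbon hk hb1 hb0
    exact ⟨γ, _, hs.snoc hq hγ⟩

/-- Jumps go from left to right, so up to and including the jump from `q` the diagonal `q + k + 1`
is that of `α`. The cell below the new initial cell lies on it, hence belongs to `α`. -/
theorem isHorizontalStripTiling (h : Strip k α β S P) (hk : 1 ≤ k) :
    IsHorizontalStripTiling k α β P := by
  induction h with
  | nil => exact ⟨le_rfl, by simp, by simp, by simp, by simp⟩
  | @snoc β γ S P q hs hq ha ih =>
    have hle1 := YoungDiagram.cells_subset_iff.2 ha.le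
    have hle2 := YoungDiagram.cells_subset_iff.2 hs.le
    refine ⟨hs.le.trans ha.le, ?_, ?_, ?_, ?_⟩
    · intro R hR
      rcases Finset.mem_insert.1 hR with rfl | hR
      · exact ha.isRibbonAt.isRibbon
      · exact ih.ribbon R hR
    · rw [Finset.coe_insert, Set.pairwiseDisjoint_insert]
      refine ⟨ih.disjoint, fun R hR _ => ?_⟩
      have h1 := hs.subset_cells hR
      rw [id, id, Finset.disjoint_left]
      intro c hc hc'
      have h2 := h1 hc'
      rw [Finset.mem_sdiff] at hc h2
      exact hc.2 h2.1
    · rw [Finset.biUnion_insert, ih.cover, id]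
      ext c
      have h1 := @hle1 c
      have h2 := @hle2 c
      simp only [Finset.mem_union, Finset.mem_sdiff]
      tauto
    · intro R hR
      rcases Finset.mem_insert.1 hR with rfl | hR
      · refine ⟨diagCell (q + k) (dlen β (q + k)), (ha.isRibbonAt.isInitialCell_iff hk).2 ⟨?_, ?_⟩,
          ?_⟩
        · simp only [content, diagCell]; omega
        · rfl
        · set a := diagCell (q + k) (dlen β (q + k)) with ha'
          have hca : content a = q + k := by rw [ha']; simp only [content, diagCell]; omega
          have hmem : a ∈ γ := by
            rw [ha', diagCell_mem, ha, if_pos ⟨by omega, le_rfl⟩]; omega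
          have hnot : a ∉ α := fun h => by
            have := hs.le h
            rw [ha', diagCell_mem] at this
            exact lt_irrefl _ this
          have h1 : α.colLen a.2 ≤ a.1 := by
            by_contra! h
            exact hnot (YoungDiagram.mem_iff_lt_colLen.2 h)
          by_contra hne
          -- Here `a.1` is positive, being larger than `α.colLen a.2` by `h1` and `hne`, so the
          -- truncated subtraction is harmless.
          have h2 : (a.1 - 1, a.2) ∈ γ := mem_of_le (c := a) (Nat.sub_le _ _) le_rfl hmem
          have h3 : content (a.1 - 1, a.2) = q + k + 1 := by
            simp only [content] at hca ⊢
            omega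
          have h4 : dlen γ (q + k + 1) = dlen α (q + k + 1) := by
            rw [ha, if_neg (by omega), hs.dlen_eq, Finset.filter_false_of_mem]
            · simp
            · intro p hp
              have := hq p hp
              omega
          rw [mem_iff_dlen, h3, h4, ← h3, ← mem_iff_dlen, YoungDiagram.mem_iff_lt_colLen] at h2
          omega
      · exact ih.initial R hR

end Strip

/-! ### Peeling off the ribbons of a horizontal strip -/

namespace IsHorizontalStripTiling

variable {k : ℕ} {α β : YoungDiagram} {P : Finset (Finset Cell)}

theorem notMem (h : IsHorizontalStripTiling k α β P) {R : Finset Cell} (hR : R ∈ P) {c : Cell}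
    (hc : c ∈ R) : c ∈ β ∧ c ∉ α := by
  have h1 : c ∈ P.biUnion id := Finset.mem_biUnion.2 ⟨R, hR, hc⟩
  rw [h.cover, Finset.mem_sdiff] at h1
  exact h1

/-- On the diagonal of the initial cell of `R'`, other ribbons of the tiling lie outside. -/
theorem row_lt_initial (h : IsHorizontalStripTiling k α β P) (hk : 1 ≤ k) {R R' : Finset Cell}
    (hR : R ∈ P) (hR' : R' ∈ P) (hne : R ≠ R') {p p' : ℤ} {ρ ρ' : ℤ → ℕ}
    (hr : IsRibbonAt k p ρ R) (hr' : IsRibbonAt k p' ρ' R') (h1 : p < p' + k) (h2 : p' ≤ p) :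
    ρ' (p' + k) < ρ (p' + k) := by
  obtain ⟨a, ha, ha1⟩ := h.initial R' hR'
  obtain ⟨a2, a3⟩ := (hr'.isInitialCell_iff hk).1 ha
  have h0 : p' + (k : ℤ) ≤ p + k := by omega
  generalize p' + (k : ℤ) = d at *
  have hn := hr.nonneg d h1 (by omega)
  have hc : content (ρ d, (ρ d + d).toNat) = d := by simp only [content]; omega
  have hcR : (ρ d, (ρ d + d).toNat) ∈ R := (hr.mem _).2 (by rw [hc]; exact ⟨h1, by omega, rfl⟩)
  by_contra! hle
  rcases hle.lt_or_eq with hlt | heq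
  -- A cell of `R` lower on this diagonal would lie to the left of a cell of `α` beneath the initial
  -- cell of `R'`, hence in `α`.
  · have h4 : (ρ d, a.2) ∈ α := YoungDiagram.mem_iff_lt_colLen.2 (by omega)
    refine (h.notMem hR hcR).2 (mem_of_le (c := (ρ d, a.2)) le_rfl ?_ h4)
    simp only [content] at a2 ⊢
    omega
  · have h4 : (ρ d, (ρ d + d).toNat) = a := by
      simp only [content] at a2
      ext
      · dsimp only; omega
      · dsimp only; omega
    rw [h4] at hcR
    exact Finset.disjoint_left.1 (h.disjoint hR hR' hne) hcR ha.1

/-- The order at the initial cell of `R'` persists towards smaller contents: the rows change by at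
most one per step, and disjoint ribbons cannot meet on a diagonal. -/
theorem row_lt (h : IsHorizontalStripTiling k α β P) (hk : 1 ≤ k) {R R' : Finset Cell}
    (hR : R ∈ P) (hR' : R' ∈ P) (hne : R ≠ R') {p p' : ℤ} {ρ ρ' : ℤ → ℕ}
    (hr : IsRibbonAt k p ρ R) (hr' : IsRibbonAt k p' ρ' R') (h2 : p' ≤ p) {d : ℤ} (h3 : p < d)
    (h4 : d ≤ p' + k) : ρ' d < ρ d := by
  obtain ⟨m, hm⟩ : ∃ m : ℕ, d = p' + k - m := ⟨(p' + k - d).toNat, by omega⟩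
  induction m generalizing d with
  | zero =>
    have : d = p' + k := by simpa using hm
    subst this
    exact h.row_lt_initial hk hR hR' hne hr hr' h3 h2
  | succ m ih =>
    have h5 := ih (d := d + 1) (by omega) (by push_cast at hm; omega) (by push_cast at hm; omega)
    have h6 := hr.step d h3 (by push_cast at hm; omega)
    have h7 := hr'.step d (by omega) (by push_cast at hm; omega)
    have h8 : ρ' d ≠ ρ d := by
      intro e
      have hn := hr.nonneg d h3 (by omega)
      have hc : content (ρ d, (ρ d + d).toNat) = d := by simp only [content]; omega
      refine Finset.disjoint_left.1 (h.disjoint hR hR' hne)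
        (show (ρ d, (ρ d + d).toNat) ∈ R from (hr.mem _).2 ?_)
        (show (ρ d, (ρ d + d).toNat) ∈ R' from (hr'.mem _).2 ?_)
      · rw [hc]; exact ⟨h3, by omega, rfl⟩
      · rw [hc]; exact ⟨by omega, by omega, e.symm⟩
    omega

/-- The ribbon of largest content can be removed from a horizontal ribbon strip. -/
theorem exists_addRibbon (h : IsHorizontalStripTiling k α β P) (hk : 1 ≤ k) (hP : P.Nonempty) :
    ∃ R ∈ P, ∃ p β', AddRibbon k p β' β ∧ β.cells \ β'.cells = R ∧
      IsHorizontalStripTiling k α β' (P.erase R) ∧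
      ∀ R' ∈ P.erase R, ∀ p' ρ', IsRibbonAt k p' ρ' R' → p' < p := by
  have hex : ∀ R ∈ P, ∃ p ρ, IsRibbonAt k p ρ R := fun R hR => (h.ribbon R hR).exists_isRibbonAt
  have huniq : ∀ {R p p' ρ ρ'}, IsRibbonAt k p ρ R → IsRibbonAt k p' ρ' R → R ∈ P → p = p' := by
    intro R p p' ρ ρ' hr hr' hR
    obtain ⟨a, ha, -⟩ := h.initial R hR
    have h1 := ((hr.isInitialCell_iff hk).1 ha).1
    have h2 := ((hr'.isInitialCell_iff hk).1 ha).1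
    omega
  choose! f g hfg using hex
  obtain ⟨R, hR, hmax⟩ := Finset.exists_max_image P f hP
  have hr := hfg R hR
  set p := f R
  set ρ := g R
  have hlt : ∀ R' ∈ P.erase R, ∀ p' ρ', IsRibbonAt k p' ρ' R' → p' < p := by
    intro R' hR' p' ρ' hr'
    obtain ⟨hne, hR'⟩ := Finset.mem_erase.1 hR'
    have h1 := hmax R' hR'
    rw [huniq (hfg R' hR') hr' hR'] at h1
    refine lt_of_le_of_ne h1 ?_
    rintro rfl
    -- With equal contents, each ribbon would lie strictly above the other on the last diagonal.
    have h2 := h.row_lt_initial hk hR hR' hne.symm hr hr' (by omega) le_rfl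
    have h3 := h.row_lt_initial hk hR' hR hne hr' hr (by omega) le_rfl
    omega
  have hcov : ∀ c, c ∈ β → c ∉ α → c ∉ R → ∃ R' ∈ P.erase R, c ∈ R' := by
    intro c h1 h2 h3
    have h4 : c ∈ P.biUnion id := by
      rw [h.cover, Finset.mem_sdiff]
      exact ⟨h1, h2⟩
    obtain ⟨R', hR', hc⟩ := Finset.mem_biUnion.1 h4
    exact ⟨R', Finset.mem_erase.2 ⟨fun e => h3 (e ▸ hc), hR'⟩, hc⟩
  -- `R` can be removed once no other ribbon sits directly above it or to its right. If `R'` sits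
  -- above, then on a diagonal common to both, `d - 1` or `d`, the inequality `row_lt` contradicts
  -- the step condition.
  have hstep1 : ∀ i j : ℕ, (i, j) ∈ R → (i + 1, j) ∈ β → (i + 1, j) ∈ R := by
    intro i j hc hc'
    by_contra hcR
    have hα : (i, j) ∉ α := (h.notMem hR hc).2
    obtain ⟨R', hR'e, hcR'⟩ := hcov _ hc' (fun h' => hα (mem_of_le (c := (i + 1, j)) (Nat.le_succ i) le_rfl h')) hcR
    obtain ⟨hne, hR'⟩ := Finset.mem_erase.1 hR'e
    have hr' := hfg R' hR'
    have hp := hlt R' hR'e _ _ hr'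
    set p' := f R'
    set ρ' := g R'
    obtain ⟨e1, e2, e3⟩ := (hr.mem _).1 hc
    obtain ⟨e1', e2', e3'⟩ := (hr'.mem _).1 hcR'
    have hd : content (i + 1, j) + 1 = content (i, j) := by
      simp only [content]; push_cast; ring
    have hd' : content (i + 1, j) = content (i, j) - 1 := by omega
    rw [hd'] at e1' e2' e3'
    generalize content (i, j) = d at *
    dsimp only at e3 e3'
    by_cases c1 : p < d - 1
    · have h5 := h.row_lt hk hR hR' hne.symm hr hr' hp.le c1 e2'
      have h6 := hr.step (d - 1) c1 (by omega)
      rw [sub_add_cancel] at h6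
      omega
    · by_cases c2 : d ≤ p' + k
      · have h5 := h.row_lt hk hR hR' hne.symm hr hr' hp.le e1 c2
        have h6 := hr'.step (d - 1) e1' (by omega)
        rw [sub_add_cancel] at h6
        omega
      -- With no common diagonal the cell above is the initial cell of `R'`. All cells beneath it
      -- are in `α`, but `(i, j)` is not.
      · obtain ⟨a, ha, ha1⟩ := h.initial R' hR'
        obtain ⟨a2, a3⟩ := (hr'.isInitialCell_iff hk).1 ha
        rw [show p' + (k : ℤ) = d - 1 by omega] at a2 a3
        have h7 : a = (i + 1, j) := by
          ext
          · dsimp only; omega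
          · simp only [content] at a2 hd'
            push_cast at hd'
            dsimp only
            omega
        rw [h7] at ha1
        dsimp only at ha1
        exact hα (YoungDiagram.mem_iff_lt_colLen.2 (by omega))
  have hstep2 : ∀ i j : ℕ, (i, j) ∈ R → (i, j + 1) ∈ β → (i, j + 1) ∈ R := by
    intro i j hc hc'
    by_contra hcR
    have hα : (i, j) ∉ α := (h.notMem hR hc).2
    obtain ⟨R', hR'e, hcR'⟩ := hcov _ hc' (fun h' => hα (mem_of_le (c := (i, j + 1)) le_rfl (Nat.le_succ j) h')) hcR
    obtain ⟨hne, hR'⟩ := Finset.mem_erase.1 hR'e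
    have hr' := hfg R' hR'
    have hp := hlt R' hR'e _ _ hr'
    set p' := f R'
    set ρ' := g R'
    obtain ⟨e1, e2, e3⟩ := (hr.mem _).1 hc
    obtain ⟨e1', e2', e3'⟩ := (hr'.mem _).1 hcR'
    have hd : content (i, j + 1) = content (i, j) + 1 := by
      simp only [content]; push_cast; ring
    rw [hd] at e1' e2' e3'
    generalize content (i, j) = d at *
    dsimp only at e3 e3'
    -- On diagonal `d + 1` the cell of `R` would be strictly above row `i`, although rows do not
    -- increase with the content.
    have h5 := h.row_lt hk hR hR' hne.symm hr hr' hp.le (d := d + 1) (by omega) e2'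
    have h6 := hr.step d e1 (by omega)
    omega
  have hup1 : ∀ m i j : ℕ, (i, j) ∈ R → (i + m, j) ∈ β → (i + m, j) ∈ R := by
    intro m
    induction m with
    | zero => intro i j h _; exact h
    | succ m ih =>
      intro i j h1 h2
      exact hstep1 _ _ (ih i j h1 (mem_of_le (c := (i + (m + 1), j)) (by dsimp only; omega) le_rfl h2)) h2
  have hup2 : ∀ m i j : ℕ, (i, j) ∈ R → (i, j + m) ∈ β → (i, j + m) ∈ R := by
    intro m
    induction m with
    | zero => intro i j h _; exact h
    | succ m ih =>
      intro i j h1 h2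
      exact hstep2 _ _ (ih i j h1 (mem_of_le (c := (i, j + (m + 1))) le_rfl (by dsimp only; omega) h2)) h2
  let β' : YoungDiagram :=
    { cells := β.cells \ R
      isLowerSet := by
        rintro ⟨i, j⟩ ⟨i', j'⟩ hle hc
        obtain ⟨l1, l2⟩ := Prod.mk_le_mk.1 hle
        simp only [Finset.coe_sdiff, Set.mem_sdiff, Finset.mem_coe] at hc ⊢
        refine ⟨mem_of_le (c := (i, j)) l1 l2 hc.1, fun hR' => hc.2 ?_⟩
        obtain ⟨m, rfl⟩ := Nat.exists_eq_add_of_le l1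
        obtain ⟨m', rfl⟩ := Nat.exists_eq_add_of_le l2
        exact hup2 _ _ _ (hup1 _ _ _ hR' (mem_of_le (c := (i' + m, j' + m')) le_rfl
          (Nat.le_add_right _ _) hc.1)) hc.1 }
  have hmem : ∀ c, c ∈ β' ↔ c ∈ β ∧ c ∉ R := fun c => by
    rw [← YoungDiagram.mem_cells]
    simp only [β', Finset.mem_sdiff, YoungDiagram.mem_cells]
  have hR' : β.cells \ β'.cells = R := by
    ext c
    rw [Finset.mem_sdiff, YoungDiagram.mem_cells, YoungDiagram.mem_cells, hmem]
    have := fun hc => (h.notMem hR (c := c) hc).1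
    tauto
  have hle : β' ≤ β := fun c hc => ((hmem c).1 hc).1
  refine ⟨R, hR, p, β', AddRibbon.of_isRibbonAt (ρ := ρ) hle (by rw [hR']; exact hr), hR',
    ⟨?_, ?_, ?_, ?_, ?_⟩, hlt⟩
  · exact fun c hc => (hmem c).2 ⟨h.le hc, fun hcR => (h.notMem hR hcR).2 hc⟩
  · exact fun R' hR' => h.ribbon R' (Finset.mem_of_mem_erase hR')
  · exact h.disjoint.subset (by simp)
  · ext c
    rw [Finset.mem_biUnion, Finset.mem_sdiff, YoungDiagram.mem_cells, YoungDiagram.mem_cells, hmem]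
    constructor
    · rintro ⟨R', hR', hc⟩
      obtain ⟨hne, hR'⟩ := Finset.mem_erase.1 hR'
      have h1 := h.notMem hR' hc
      exact ⟨⟨h1.1, fun hcR => Finset.disjoint_left.1 (h.disjoint hR' hR hne) hc hcR⟩, h1.2⟩
    · rintro ⟨⟨h1, h2⟩, h3⟩
      exact hcov c h1 h3 h2
  · exact fun R' hR' => h.initial R' (Finset.mem_of_mem_erase hR')

/-- Removing the ribbon of largest content repeatedly and reading the removals backwards gives jumps
in increasing order. -/
theorem exists_strip (h : IsHorizontalStripTiling k α β P) (hk : 1 ≤ k) :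
    ∃ S, Strip k α β S P := by
  induction hn : P.card generalizing β P with
  | zero =>
    rw [Finset.card_eq_zero] at hn
    subst hn
    have h1 := h.cover
    rw [Finset.biUnion_empty] at h1
    have h2 : α = β := le_antisymm h.le
      (YoungDiagram.cells_subset_iff.1 (Finset.sdiff_eq_empty_iff_subset.1 h1.symm))
    subst h2
    exact ⟨∅, .nil⟩
  | succ n ih =>
    obtain ⟨R, hR, p, β', ha, hRe, ht, hlt⟩ := h.exists_addRibbon hk
      (Finset.card_pos.1 (by omega))
    obtain ⟨S, hS⟩ := ih ht (by rw [Finset.card_erase_of_mem hR]; omega)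
    refine ⟨insert p S, ?_⟩
    rw [← Finset.insert_erase hR, ← hRe]
    rw [← hRe] at hS
    refine hS.snoc (fun p' hp' => ?_) ha
    obtain ⟨R', hR', ρ', hr'⟩ := hS.exists_isRibbonAt hp'
    rw [hRe] at hR'
    exact hlt R' hR' p' ρ' hr'

end IsHorizontalStripTiling

/-! ### The two-row vertex model and its intertwiner -/

section VertexModel

variable {K : Type*} [CommRing K]

/-- Weight of a vertex of the two-row model: the bead states of a site before and after both rows
are `a` and `c`, the beads in flight that arrive at and leave the site are recorded by `f` and `g`
(one entry for each row), and `m` and `n` other beads are in flight over the site. -/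
def vertexWeight (x y t : K) (a c : Bool) (f g : Bool × Bool) (m n : ℕ) : K :=
  if a.toNat + f.1.toNat ≤ 1 ∧ g.1.toNat ≤ a.toNat + f.1.toNat ∧
      a.toNat + f.1.toNat - g.1.toNat + f.2.toNat ≤ 1 ∧
      g.2.toNat + c.toNat = a.toNat + f.1.toNat - g.1.toNat + f.2.toNat then
    x ^ g.1.toNat * y ^ g.2.toNat * t ^ ((a.toNat + f.1.toNat) * m +
      (a.toNat + f.1.toNat - g.1.toNat + f.2.toNat) * n)
  else 0

/-- The factor by which the intertwiner grows when a leg is added in front. -/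
def consFactor (z s : K) (n d : ℕ) : Bool × Bool → Bool × Bool → K
  | (false, false), (false, false) => 1
  | (true, false), (true, false) => 1
  | (false, true), (false, true) => z * s ^ d
  | (false, true), (true, false) => s ^ n * (1 - z * s ^ (2 * d))
  | (true, true), (true, true) => z * s ^ d
  | _, _ => 0

/-- The factor by which the intertwiner grows when a leg is added at the end. -/
def snocFactor (z s : K) (n d : ℕ) : Bool × Bool → Bool × Bool → K
  | (false, false), (false, false) => 1
  | (true, false), (true, false) => s ^ d
  | (false, true), (false, true) => z
  | (false, true), (true, false) => s ^ n * (1 - z * s ^ (2 * d))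
  | (true, true), (true, true) => z * s ^ d
  | _, _ => 0

/-- A leg that the intertwiner moves from the second row to the first one. -/
def moved (f f' : Bool × Bool) : ℕ :=
  if f = (false, true) ∧ f' = (true, false) then 1 else 0

/-- Adding a leg at one end shifts the counts seen by the factor at the other end. This commutation
makes the descriptions of the intertwiner from the front and from the back agree. -/
theorem consFactor_mul_snocFactor (z s : K) (n n' d : ℕ) (f f' g g' : Bool × Bool) :
    consFactor z s (n + g.1.toNat) (d + moved g g') f f' * snocFactor z s n' d g g' =
      snocFactor z s (n' + f'.2.toNat) (d + moved f f') g g' * consFactor z s n d f f' := by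
  obtain ⟨_ | _, _ | _⟩ := f <;> obtain ⟨_ | _, _ | _⟩ := f' <;>
  obtain ⟨_ | _, _ | _⟩ := g <;> obtain ⟨_ | _, _ | _⟩ := g' <;>
  simp [consFactor, snocFactor, moved] <;> ring

set_option maxHeartbeats 4000000 in
/-- The Yang–Baxter equation of the two-row model, for one vertex. -/
theorem sum_vertexWeight_mul_snocFactor {y z t s : K} (hts : t * s = 1) (a c : Bool)
    (f g' : Bool × Bool) (n m d : ℕ) :
    ∑ g, vertexWeight (z * y) y t a c f g n (m + d) * snocFactor z s m d g g' =
      ∑ f', consFactor z s n d f f' * vertexWeight y (z * y) t a c f' g' (n + d) m := by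
  have hn : t ^ n * s ^ n = 1 := by rw [← mul_pow, hts, one_pow]
  have hm : t ^ m * s ^ m = 1 := by rw [← mul_pow, hts, one_pow]
  have hd : t ^ d * s ^ d = 1 := by rw [← mul_pow, hts, one_pow]
  -- Each of the 64 boundary states gives a polynomial identity in the named powers, modulo the
  -- three relations `hn`, `hm`, `hd`.
  obtain ⟨_ | _, _ | _⟩ := f <;> obtain ⟨_ | _, _ | _⟩ := g' <;> cases a <;> cases c <;>
  simp [vertexWeight, consFactor, snocFactor, Fintype.sum_prod_type, pow_add, mul_comm 2 d, pow_mul] <;>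
  generalize t ^ n = A at * <;> generalize s ^ n = A' at * <;>
  generalize t ^ m = B at * <;> generalize s ^ m = B' at * <;>
  generalize t ^ d = C at * <;> generalize s ^ d = C' at * <;>
  grind

/-- The number of legs with a bead in the first row. -/
def countFst {m : ℕ} (σ : Fin m → Bool × Bool) : ℕ := ∑ i, (σ i).1.toNat

/-- The number of legs with a bead in the second row. -/
def countSnd {m : ℕ} (σ : Fin m → Bool × Bool) : ℕ := ∑ i, (σ i).2.toNat

/-- The number of moved legs. -/
def countMoved {m : ℕ} (σ τ : Fin m → Bool × Bool) : ℕ := ∑ i, moved (σ i) (τ i)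

/-- The intertwiner of the two-row model. -/
def intertwiner (z s : K) : (m : ℕ) → (Fin m → Bool × Bool) → (Fin m → Bool × Bool) → K
  | 0, _, _ => 1
  | m + 1, σ, τ => consFactor z s (countFst (Fin.tail σ)) (countMoved (Fin.tail σ) (Fin.tail τ))
      (σ 0) (τ 0) * intertwiner z s m (Fin.tail σ) (Fin.tail τ)

theorem countFst_snoc {m : ℕ} (σ : Fin m → Bool × Bool) (g : Bool × Bool) :
    countFst (Fin.snoc (α := fun _ => Bool × Bool) σ g) = countFst σ + g.1.toNat := by
  simp [countFst, Fin.sum_univ_castSucc]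

theorem countMoved_snoc {m : ℕ} (σ τ : Fin m → Bool × Bool) (g g' : Bool × Bool) :
    countMoved (Fin.snoc (α := fun _ => Bool × Bool) σ g)
      (Fin.snoc (α := fun _ => Bool × Bool) τ g') = countMoved σ τ + moved g g' := by
  simp [countMoved, Fin.sum_univ_castSucc]

/-- Passing a site removes the front leg and appends a leg at the back, so the recursion from the
front has to be complemented by one from the back. -/
theorem intertwiner_snoc (z s : K) {m : ℕ} (σ τ : Fin m → Bool × Bool) (g g' : Bool × Bool) :
    intertwiner z s (m + 1) (Fin.snoc (α := fun _ => Bool × Bool) σ g)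
      (Fin.snoc (α := fun _ => Bool × Bool) τ g') =
    snocFactor z s (countSnd τ) (countMoved σ τ) g g' * intertwiner z s m σ τ := by
  induction m with
  | zero =>
    obtain ⟨_ | _, _ | _⟩ := g <;> obtain ⟨_ | _, _ | _⟩ := g' <;>
    simp [intertwiner, countFst, countSnd, countMoved, consFactor, snocFactor, Fin.snoc]
  | succ m ih =>
    have hσ : Fin.tail (Fin.snoc (α := fun _ => Bool × Bool) σ g) =
        Fin.snoc (α := fun _ => Bool × Bool) (Fin.tail σ) g := by
      conv_lhs => rw [← Fin.cons_self_tail σ, ← Fin.cons_snoc_eq_snoc_cons]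
      simp
    have hτ : Fin.tail (Fin.snoc (α := fun _ => Bool × Bool) τ g') =
        Fin.snoc (α := fun _ => Bool × Bool) (Fin.tail τ) g' := by
      conv_lhs => rw [← Fin.cons_self_tail τ, ← Fin.cons_snoc_eq_snoc_cons]
      simp
    rw [intertwiner, hσ, hτ, ih, countFst_snoc, countMoved_snoc, ← mul_assoc]
    have h0 : (Fin.snoc (α := fun _ => Bool × Bool) σ g) 0 = σ 0 := rfl
    have h0' : (Fin.snoc (α := fun _ => Bool × Bool) τ g') 0 = τ 0 := rfl
    have h1 : countSnd τ = countSnd (Fin.tail τ) + (τ 0).2.toNat := by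
      rw [countSnd, Fin.sum_univ_succ, add_comm]; rfl
    have h2 : countMoved σ τ = countMoved (Fin.tail σ) (Fin.tail τ) + moved (σ 0) (τ 0) := by
      rw [countMoved, Fin.sum_univ_succ, add_comm]; rfl
    rw [h0, h0', consFactor_mul_snocFactor, h1, h2, intertwiner, mul_assoc]

theorem consFactor_ne_zero {z s : K} {n d : ℕ} {f f' : Bool × Bool}
    (h : consFactor z s n d f f' ≠ 0) :
    f'.1.toNat = f.1.toNat + moved f f' ∧ f.2.toNat = f'.2.toNat + moved f f' := by
  obtain ⟨_ | _, _ | _⟩ := f <;> obtain ⟨_ | _, _ | _⟩ := f' <;>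
  simp [consFactor, moved] at h ⊢

/-- Beads are conserved: a moved leg takes one bead from the second row to the first. This matches
the in-flight counts on the two sides of the vertex relation. -/
theorem count_of_intertwiner_ne_zero {z s : K} {m : ℕ} {σ τ : Fin m → Bool × Bool}
    (h : intertwiner z s m σ τ ≠ 0) :
    countFst τ = countFst σ + countMoved σ τ ∧ countSnd σ = countSnd τ + countMoved σ τ := by
  induction m with
  | zero => simp [countFst, countSnd, countMoved]
  | succ m ih =>
    rw [intertwiner] at h
    have h1 := ih (right_ne_zero_of_mul h)
    have h2 := consFactor_ne_zero (left_ne_zero_of_mul h)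
    have e : ∀ ρ : Fin (m + 1) → Bool × Bool, countFst ρ = (ρ 0).1.toNat + countFst (Fin.tail ρ) :=
      fun ρ => by rw [countFst, Fin.sum_univ_succ]; rfl
    have e' : ∀ ρ : Fin (m + 1) → Bool × Bool, countSnd ρ = (ρ 0).2.toNat + countSnd (Fin.tail ρ) :=
      fun ρ => by rw [countSnd, Fin.sum_univ_succ]; rfl
    have e'' : countMoved σ τ = moved (σ 0) (τ 0) + countMoved (Fin.tail σ) (Fin.tail τ) := by
      rw [countMoved, Fin.sum_univ_succ]; rfl
    rw [e, e σ, e', e' τ, e'']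
    omega

/-- No entry of `consFactor` turns an empty leg into an occupied one. -/
theorem intertwiner_zero_left (z s : K) {m : ℕ} (τ : Fin m → Bool × Bool) :
    intertwiner z s m (fun _ => (false, false)) τ = if τ = fun _ => (false, false) then 1 else 0 := by
  induction m with
  | zero => simp [intertwiner, Subsingleton.elim τ (fun _ => (false, false))]
  | succ m ih =>
    rw [← Fin.cons_self_tail τ]
    have h0 : (fun _ => (false, false) : Fin (m + 1) → Bool × Bool) =
        Fin.cons (α := fun _ => Bool × Bool) (false, false) (fun _ => (false, false)) := by
      ext i <;> refine Fin.cases ?_ (fun j => ?_) i <;> simp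
    rw [h0, intertwiner, Fin.tail_cons, Fin.tail_cons, ih, Fin.cons_zero, Fin.cons_zero]
    simp only [Fin.cons_inj]
    by_cases h : Fin.tail τ = fun _ => (false, false)
    · generalize τ 0 = f
      obtain ⟨_ | _, _ | _⟩ := f <;> simp [h, consFactor]
    · simp [h]

theorem intertwiner_zero_right (z s : K) {m : ℕ} (σ : Fin m → Bool × Bool) :
    intertwiner z s m σ (fun _ => (false, false)) = if σ = fun _ => (false, false) then 1 else 0 := by
  induction m with
  | zero => simp [intertwiner, Subsingleton.elim σ (fun _ => (false, false))]
  | succ m ih =>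
    rw [← Fin.cons_self_tail σ]
    have h0 : (fun _ => (false, false) : Fin (m + 1) → Bool × Bool) =
        Fin.cons (α := fun _ => Bool × Bool) (false, false) (fun _ => (false, false)) := by
      ext i <;> refine Fin.cases ?_ (fun j => ?_) i <;> simp
    rw [h0, intertwiner, Fin.tail_cons, Fin.tail_cons, ih, Fin.cons_zero, Fin.cons_zero]
    simp only [Fin.cons_inj]
    by_cases h : Fin.tail σ = fun _ => (false, false)
    · generalize σ 0 = f
      obtain ⟨_ | _, _ | _⟩ := f <;> simp [h, consFactor]
    · simp [h]

/-- The partition function of the two-row model on the sites `0, …, n - 1`, when the legs `σ` enter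
on the left and no legs leave on the right. -/
def partitionFunction (x y t : K) {m : ℕ} :
    (n : ℕ) → (ℕ → Bool) → (ℕ → Bool) → (Fin (m + 1) → Bool × Bool) → K
  | 0, _, _, σ => if σ = fun _ => (false, false) then 1 else 0
  | n + 1, a, c, σ => ∑ g, vertexWeight x y t (a 0) (c 0) (σ 0) g (countFst (Fin.tail σ))
      (countSnd (Fin.tail σ)) * partitionFunction x y t n (fun i => a (i + 1)) (fun i => c (i + 1))
        (Fin.snoc (α := fun _ => Bool × Bool) (Fin.tail σ) g)

theorem sum_eq_sum_cons {m : ℕ} (F : (Fin (m + 1) → Bool × Bool) → K) :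
    ∑ τ, F τ = ∑ ρ : Fin m → Bool × Bool, ∑ f, F (Fin.cons (α := fun _ => Bool × Bool) f ρ) := by
  rw [← (Fin.consEquiv fun _ : Fin (m + 1) => Bool × Bool).sum_comp, Fintype.sum_prod_type,
    Finset.sum_comm]
  rfl

theorem sum_eq_sum_snoc {m : ℕ} (F : (Fin (m + 1) → Bool × Bool) → K) :
    ∑ τ, F τ = ∑ ρ : Fin m → Bool × Bool, ∑ g, F (Fin.snoc (α := fun _ => Bool × Bool) ρ g) := by
  rw [← (Fin.snocEquiv fun _ : Fin (m + 1) => Bool × Bool).sum_comp, Fintype.sum_prod_type,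
    Finset.sum_comm]
  rfl

/-- Zipper argument: the induction hypothesis puts the intertwiner after the first site, its back
factor is split off, and the vertex relation turns it into the front factor of the intertwiner
before that site, with the row weights interchanged. -/
theorem partitionFunction_eq_sum {y z t s : K} (hts : t * s = 1) {m : ℕ} (n : ℕ) (a c : ℕ → Bool)
    (σ : Fin (m + 1) → Bool × Bool) :
    partitionFunction (z * y) y t n a c σ =
      ∑ τ, intertwiner z s (m + 1) σ τ * partitionFunction y (z * y) t n a c τ := by
  induction n generalizing a c σ with
  | zero => simp [partitionFunction, intertwiner_zero_right]
  | succ n ih =>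
    set ρ := Fin.tail σ with hρ
    have hL : ∀ g, partitionFunction (z * y) y t n (fun i => a (i + 1)) (fun i => c (i + 1))
          (Fin.snoc (α := fun _ => Bool × Bool) ρ g) =
        ∑ ρ', ∑ g', snocFactor z s (countSnd ρ') (countMoved ρ ρ') g g' * intertwiner z s m ρ ρ' *
          partitionFunction y (z * y) t n (fun i => a (i + 1)) (fun i => c (i + 1))
            (Fin.snoc (α := fun _ => Bool × Bool) ρ' g') := by
      intro g
      rw [ih, sum_eq_sum_snoc]
      simp only [intertwiner_snoc]
    rw [sum_eq_sum_cons, partitionFunction, ← hρ]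
    simp only [hL, partitionFunction, intertwiner, Fin.tail_cons, Fin.cons_zero, ← hρ]
    simp only [Finset.mul_sum]
    rw [Finset.sum_comm]
    refine Finset.sum_congr rfl fun ρ' _ => ?_
    rw [Finset.sum_comm]
    conv_rhs => rw [Finset.sum_comm]
    -- The vertex relation needs the conservation laws for `ρ` and `ρ'`, which hold only where the
    -- intertwiner does not vanish.
    by_cases hW : intertwiner z s m ρ ρ' = 0
    · simp [hW]
    obtain ⟨h1, h2⟩ := count_of_intertwiner_ne_zero hW
    refine Finset.sum_congr rfl fun g' _ => ?_
    have := sum_vertexWeight_mul_snocFactor (y := y) (z := z) hts (a 0) (c 0) (σ 0) g'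
      (countFst ρ) (countSnd ρ') (countMoved ρ ρ')
    rw [← h1, ← h2] at this
    calc _ = (∑ g, vertexWeight (z * y) y t (a 0) (c 0) (σ 0) g (countFst ρ) (countSnd ρ) *
          snocFactor z s (countSnd ρ') (countMoved ρ ρ') g g') * (intertwiner z s m ρ ρ' *
          partitionFunction y (z * y) t n (fun i => a (i + 1)) (fun i => c (i + 1))
            (Fin.snoc (α := fun _ => Bool × Bool) ρ' g')) := by
          rw [Finset.sum_mul]
          exact Finset.sum_congr rfl fun _ _ => by ring
      _ = _ := by
          rw [this, Finset.sum_mul]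
          exact Finset.sum_congr rfl fun _ _ => by ring

/-- The partition function with empty boundary is symmetric in the weights of the rows. -/
theorem partitionFunction_comm {y z t s : K} (hts : t * s = 1) {m : ℕ} (n : ℕ) (a c : ℕ → Bool) :
    partitionFunction (m := m) (z * y) y t n a c (fun _ => (false, false)) =
      partitionFunction (m := m) y (z * y) t n a c (fun _ => (false, false)) := by
  rw [partitionFunction_eq_sum hts]
  simp [intertwiner_zero_left]

end VertexModel

/-! ### Expansion of the partition function over configurations -/

section Paths

variable {K : Type*} [CommRing K]

/-- The contribution to the partition function of the configuration in which `g i` are the legs that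
leave the site `i`. -/
def pathWeight (x y t : K) {m : ℕ} :
    (n : ℕ) → (ℕ → Bool) → (ℕ → Bool) → (Fin (m + 1) → Bool × Bool) → (Fin n → Bool × Bool) → K
  | 0, _, _, σ, _ => if σ = fun _ => (false, false) then 1 else 0
  | n + 1, a, c, σ, g => vertexWeight x y t (a 0) (c 0) (σ 0) (g 0) (countFst (Fin.tail σ))
      (countSnd (Fin.tail σ)) * pathWeight x y t n (fun i => a (i + 1)) (fun i => c (i + 1))
        (Fin.snoc (α := fun _ => Bool × Bool) (Fin.tail σ) (g 0)) (Fin.tail g)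

theorem partitionFunction_eq_sum_pathWeight (x y t : K) {m : ℕ} (n : ℕ) (a c : ℕ → Bool)
    (σ : Fin (m + 1) → Bool × Bool) :
    partitionFunction x y t n a c σ = ∑ g, pathWeight x y t n a c σ g := by
  induction n generalizing a c σ with
  | zero => simp [partitionFunction, pathWeight]
  | succ n ih =>
    rw [sum_eq_sum_cons, Finset.sum_comm, partitionFunction]
    refine Finset.sum_congr rfl fun g _ => ?_
    simp only [pathWeight, Fin.cons_zero, Fin.tail_cons, ih, Finset.mul_sum]

/-- A single sequence holds all legs: `h i` arrives at site `i`, and the leg leaving it is `h (i +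
(m + 1))`, as each jump has length `m + 1`. The `m` entries between them are in flight over the
site. -/
theorem pathWeight_eq_prod (x y t : K) {m : ℕ} (n : ℕ) (a c : ℕ → Bool) (h : ℕ → Bool × Bool) :
    pathWeight x y t n a c (fun i : Fin (m + 1) => h i) (fun i => h (m + 1 + i)) =
      (∏ i ∈ Finset.range n, vertexWeight x y t (a i) (c i) (h i) (h (i + (m + 1)))
        (∑ j ∈ Finset.range m, (h (i + 1 + j)).1.toNat)
        (∑ j ∈ Finset.range m, (h (i + 1 + j)).2.toNat)) *
      if ∀ i < m + 1, h (n + i) = (false, false) then 1 else 0 := by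
  induction n generalizing a c h with
  | zero =>
    simp only [pathWeight, Finset.range_zero, Finset.prod_empty, one_mul, zero_add]
    refine if_congr ⟨fun e i hi => congrFun e ⟨i, hi⟩, fun e => funext fun i => e i i.2⟩ rfl rfl
  | succ n ih =>
    have hs : Fin.snoc (α := fun _ => Bool × Bool) (Fin.tail fun i : Fin (m + 1) => h i)
        (h (m + 1)) = fun i : Fin (m + 1) => h (i + 1) := by
      funext i
      refine Fin.lastCases ?_ (fun j => ?_) i
      · simp
      · simp [Fin.tail]
    have h1 := ih (fun i => a (i + 1)) (fun i => c (i + 1)) (fun i => h (i + 1))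
    have hg : (Fin.tail fun i : Fin (n + 1) => h (m + 1 + i)) = fun i : Fin n => h (m + 1 + i + 1) :=
      rfl
    rw [pathWeight, hg]
    simp only [Fin.val_zero, add_zero]
    rw [hs, h1, Finset.prod_range_succ', mul_right_comm, mul_comm]
    congr 1
    · congr 1
      · refine Finset.prod_congr rfl fun i _ => ?_
        rw [show i + 1 + (m + 1) = i + (m + 1) + 1 by ring]
        simp only [show ∀ j, i + 1 + 1 + j = i + 1 + j + 1 by intro j; ring]
      · simp only [show ∀ i, n + 1 + i = n + i + 1 by intro j; ring]
    · simp only [zero_add, countFst, countSnd, Fin.tail, Fin.val_succ]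
      rw [Finset.sum_range fun j => (h (1 + j)).1.toNat, Finset.sum_range fun j => (h (1 + j)).2.toNat]
      simp only [add_comm 1]

end Paths

/-! ### Pairs of consecutive strips as configurations of the vertex model -/

theorem eq_of_bit {α β : YoungDiagram} (h : ∀ d, bit α d = bit β d) : α = β := by
  obtain ⟨M, hM⟩ := exists_dlen_eq_zero α
  obtain ⟨M', hM'⟩ := exists_dlen_eq_zero β
  have key : ∀ m : ℕ, ∀ d : ℤ, (M + M' : ℤ) - m ≤ d → dlen α d = dlen β d := by
    intro m
    induction m with
    | zero => intro d hd; rw [hM d (by push_cast at hd; omega), hM' d (by push_cast at hd; omega)]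
    | succ m ih =>
      intro d hd
      have h1 := ih (d + 1) (by push_cast at hd; omega)
      have h2 := h d
      simp only [bit] at h2
      omega
  exact eq_of_dlen fun d => key (M + M' - d).toNat d (by omega)

/-- Two consecutive horizontal ribbon strips. -/
@[ext]
structure TwoStep (k : ℕ) (α γ : YoungDiagram) where
  mid : YoungDiagram
  fst : Finset (Finset Cell)
  snd : Finset (Finset Cell)
  tiling_fst : IsHorizontalStripTiling k α mid fst
  tiling_snd : IsHorizontalStripTiling k mid γ snd

namespace TwoStep

/-- Twice the spin of two strips. -/
def height {k : ℕ} {α γ : YoungDiagram} (T : TwoStep k α γ) : ℕ :=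
  ∑ R ∈ T.fst, (RibbonTableaux.height R - 1) + ∑ R ∈ T.snd, (RibbonTableaux.height R - 1)

variable {m : ℕ} {α γ : YoungDiagram}

/-- The contents of the ribbons of the first strip. -/
noncomputable def contentsFst (T : TwoStep (m + 1) α γ) : Finset ℤ :=
  (T.tiling_fst.exists_strip (Nat.le_add_left _ _)).choose

/-- The contents of the ribbons of the second strip. -/
noncomputable def contentsSnd (T : TwoStep (m + 1) α γ) : Finset ℤ :=
  (T.tiling_snd.exists_strip (Nat.le_add_left _ _)).choose

theorem strip_fst (T : TwoStep (m + 1) α γ) : Strip (m + 1) α T.mid T.contentsFst T.fst :=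
  (T.tiling_fst.exists_strip (Nat.le_add_left _ _)).choose_spec

theorem strip_snd (T : TwoStep (m + 1) α γ) : Strip (m + 1) T.mid γ T.contentsSnd T.snd :=
  (T.tiling_snd.exists_strip (Nat.le_add_left _ _)).choose_spec

theorem ext_contents {T T' : TwoStep (m + 1) α γ} (h1 : T.contentsFst = T'.contentsFst)
    (h2 : T.contentsSnd = T'.contentsSnd) : T = T' := by
  have a := T.strip_fst
  have b := T.strip_snd
  rw [h1] at a
  rw [h2] at b
  have e := a.unique T'.strip_fst
  rw [e.1] at b
  exact TwoStep.ext e.1 e.2 (b.unique T'.strip_snd).2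

/-- The diagonals met by a ribbon are nonempty in `β`, which confines all jumps to a window of
sites. -/
theorem eq_contents {k : ℕ} {α β : YoungDiagram} {S : Finset ℤ} {P : Finset (Finset Cell)}
    (h : Strip k α β S P) (hk : 1 ≤ k) {M : ℕ} (hM : ∀ d : ℤ, (d ≤ -M ∨ M ≤ d) → dlen β d = 0)
    {p : ℤ} (hp : p ∈ S) : -(M : ℤ) ≤ p ∧ p + k < M := by
  have key : ∀ d : ℤ, p < d → d ≤ p + k → 0 < dlen β d := by
    intro d h1 h2
    rw [h.dlen_eq]
    have : 0 < (S.filter fun q => q < d ∧ d ≤ q + k).card :=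
      Finset.card_pos.2 ⟨p, Finset.mem_filter.2 ⟨hp, h1, h2⟩⟩
    omega
  constructor
  · by_contra! hlt
    have := key (p + 1) (by omega) (by omega)
    rw [hM _ (by omega)] at this
    omega
  · by_contra! hlt
    have := key (p + k) (by omega) (by omega)
    rw [hM _ (by omega)] at this
    omega

/-- The number of the ribbons in flight over a site. -/
theorem sum_range_mem (S : Finset ℤ) (s : ℤ) (m : ℕ) :
    ∑ j ∈ Finset.range m, (decide (s + 1 + j ∈ S)).toNat =
      (S.filter fun p => s < p ∧ p < s + 1 + m).card := by
  have h1 : ∀ j : ℕ, (decide (s + 1 + j ∈ S)).toNat = if s + 1 + (j : ℤ) ∈ S then 1 else 0 := by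
    intro j
    by_cases h : s + 1 + (j : ℤ) ∈ S <;> simp [h]
  simp only [h1]
  rw [← Finset.card_filter]
  refine Finset.card_bij (fun j _ => s + 1 + (j : ℤ)) ?_ ?_ ?_
  · intro j hj
    rw [Finset.mem_filter, Finset.mem_range] at hj
    rw [Finset.mem_filter]
    exact ⟨hj.2, by omega, by omega⟩
  · intro j _ j' _ h
    omega
  · intro p hp
    rw [Finset.mem_filter] at hp
    refine ⟨(p - s - 1).toNat, ?_, by omega⟩
    rw [Finset.mem_filter, Finset.mem_range, show s + 1 + ((p - s - 1).toNat : ℤ) = p by omega]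
    exact ⟨by omega, hp.1⟩

/-- Double counting of the beads jumped over. -/
theorem sum_mul_card (S : Finset ℤ) (u : ℤ → ℕ) (M k : ℕ)
    (hM : ∀ p ∈ S, -(M : ℤ) ≤ p ∧ p + k < M) :
    ∑ i ∈ Finset.range (2 * M),
      u (i - M) * (S.filter fun p => (i : ℤ) - M - k < p ∧ p < i - M).card =
      ∑ p ∈ S, ∑ d ∈ Finset.Ioo p (p + k), u d := by
  simp only [Finset.card_filter, Finset.mul_sum]
  rw [Finset.sum_comm]
  refine Finset.sum_congr rfl fun p hp => ?_
  simp only [mul_ite, mul_one, mul_zero]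
  rw [← Finset.sum_filter]
  have := hM p hp
  refine Finset.sum_bij (fun i _ => (i : ℤ) - M) ?_ ?_ ?_ ?_
  · intro i hi
    rw [Finset.mem_filter] at hi
    rw [Finset.mem_Ioo]
    omega
  · intro i _ j _ h
    omega
  · intro d hd
    rw [Finset.mem_Ioo] at hd
    refine ⟨(d + M).toNat, ?_, by omega⟩
    rw [Finset.mem_filter, Finset.mem_range]
    omega
  · intro i _
    rfl

theorem sum_mem_eq_card (S : Finset ℤ) (M : ℕ) (hM : ∀ p ∈ S, -(M : ℤ) ≤ p ∧ p < M) :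
    ∑ i ∈ Finset.range (2 * M), (decide ((i : ℤ) - M ∈ S)).toNat = S.card := by
  have h1 : ∀ i : ℕ, (decide ((i : ℤ) - M ∈ S)).toNat = if (i : ℤ) - M ∈ S then 1 else 0 := by
    intro j
    by_cases h : (j : ℤ) - M ∈ S <;> simp [h]
  simp only [h1]
  rw [← Finset.card_filter]
  refine Finset.card_bij (fun i _ => (i : ℤ) - M) ?_ ?_ ?_
  · intro i hi
    exact (Finset.mem_filter.1 hi).2
  · intro i _ j _ h
    omega
  · intro p hp
    have := hM p hp
    refine ⟨(p + M).toNat, ?_, by omega⟩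
    rw [Finset.mem_filter, Finset.mem_range, show (((p + M).toNat : ℕ) : ℤ) - M = p by omega]
    exact ⟨by omega, hp⟩

end TwoStep

/-- The boundary bits of a partition as Booleans. -/
noncomputable def boolBit (lam : YoungDiagram) (d : ℤ) : Bool := decide (bit lam d = 1)

theorem boolBit_toNat (lam : YoungDiagram) (d : ℤ) : ((boolBit lam d).toNat : ℤ) = bit lam d := by
  have h0 := bit_nonneg lam d
  have h1 := bit_le_one lam d
  by_cases h : bit lam d = 1
  · simp [boolBit, h]
  · have h2 : bit lam d = 0 := by omega
    simp [boolBit, h2]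

theorem decide_toNat (p : Prop) [Decidable p] : (decide p).toNat = if p then 1 else 0 := by
  by_cases h : p <;> simp [h]

/-- One row of vertices. -/
theorem Strip.toNat_eq {k : ℕ} {α β : YoungDiagram} {S : Finset ℤ} {P : Finset (Finset Cell)}
    (h : Strip k α β S P) (hk : 1 ≤ k) (d : ℤ) :
    (boolBit α d).toNat + (decide (d - k ∈ S)).toNat ≤ 1 ∧
      (decide (d ∈ S)).toNat ≤ (boolBit α d).toNat + (decide (d - k ∈ S)).toNat ∧
      (boolBit α d).toNat + (decide (d - k ∈ S)).toNat - (decide (d ∈ S)).toNat =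
        (boolBit β d).toNat := by
  have h1 := boolBit_toNat α d
  have h2 := boolBit_toNat β d
  have h3 := h.bit_eq hk d
  have h4 : d - k ∈ S → bit α d = 0 := fun h' => by
    simpa using h.bit_add_eq_zero hk h'
  have h5 : d ∈ S → bit α d + (if d - k ∈ S then 1 else 0) = 1 := fun h' =>
    h.bit_add_mem_eq_one hk h'
  have h6 := bit_le_one α d
  simp only [decide_toNat]
  by_cases e1 : d - k ∈ S <;> by_cases e2 : d ∈ S <;> simp only [e1, e2, if_true, if_false] at * <;>
    simp only [true_implies, false_implies] at * <;> omega

/-- Strips can be built from rows of admissible vertices. -/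
theorem Strip.exists_of_toNat {k : ℕ} (hk : 1 ≤ k) (α : YoungDiagram) (S : Finset ℤ)
    (h : ∀ d, (boolBit α d).toNat + (decide (d - k ∈ S)).toNat ≤ 1 ∧
      (decide (d ∈ S)).toNat ≤ (boolBit α d).toNat + (decide (d - k ∈ S)).toNat) :
    ∃ β P, Strip k α β S P := by
  refine Strip.exists_of_bit hk α S (fun p hp => ?_) (fun p hp => ?_)
  · have h1 := (h (p + k)).1
    have h2 := boolBit_toNat α (p + k)
    rw [add_sub_cancel_right, decide_toNat, if_pos hp] at h1
    omega
  · have h1 := h p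
    have h2 := boolBit_toNat α p
    simp only [decide_toNat, if_pos hp] at h1
    split_ifs at h1 ⊢ <;> omega

theorem vertexWeight_ne_zero {K : Type*} [CommRing K] {x y t : K} {a c : Bool}
    {f g : Bool × Bool} {m n : ℕ} (h : vertexWeight x y t a c f g m n ≠ 0) :
    a.toNat + f.1.toNat ≤ 1 ∧ g.1.toNat ≤ a.toNat + f.1.toNat ∧
      a.toNat + f.1.toNat - g.1.toNat + f.2.toNat ≤ 1 ∧
      g.2.toNat + c.toNat = a.toNat + f.1.toNat - g.1.toNat + f.2.toNat := by
  by_contra hc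
  exact h (if_neg hc)

namespace TwoStep

variable {m : ℕ} {α γ : YoungDiagram}

theorem contentsFst_bound (T : TwoStep (m + 1) α γ) {M : ℕ}
    (hM : ∀ d : ℤ, (d ≤ -M ∨ M ≤ d) → dlen γ d = 0) {p : ℤ} (hp : p ∈ T.contentsFst) :
    -(M : ℤ) ≤ p ∧ p + (m + 1 : ℕ) < M := by
  refine eq_contents T.strip_fst (Nat.le_add_left _ _) (fun d hd => ?_) hp
  have := le_iff_dlen.1 T.tiling_snd.le d
  rw [hM d hd] at this
  omega

theorem contentsSnd_bound (T : TwoStep (m + 1) α γ) {M : ℕ}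
    (hM : ∀ d : ℤ, (d ≤ -M ∨ M ≤ d) → dlen γ d = 0) {p : ℤ} (hp : p ∈ T.contentsSnd) :
    -(M : ℤ) ≤ p ∧ p + (m + 1 : ℕ) < M :=
  eq_contents T.strip_snd (Nat.le_add_left _ _) hM hp

/-- The legs of the configuration of the vertex model that corresponds to two strips. -/
noncomputable def code (M : ℕ) (T : TwoStep (m + 1) α γ) (i : Fin (2 * M)) : Bool × Bool :=
  (decide ((i : ℤ) - M ∈ T.contentsFst), decide ((i : ℤ) - M ∈ T.contentsSnd))

theorem code_injective {M : ℕ} (hM : ∀ d : ℤ, (d ≤ -M ∨ M ≤ d) → dlen γ d = 0) :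
    Function.Injective (code M : TwoStep (m + 1) α γ → _) := by
  intro T T' h
  have key : ∀ p : ℤ, -(M : ℤ) ≤ p ∧ p + (m + 1 : ℕ) < M →
      (p ∈ T.contentsFst ↔ p ∈ T'.contentsFst) ∧ (p ∈ T.contentsSnd ↔ p ∈ T'.contentsSnd) := by
    intro p hp
    have h1 := congrFun h ⟨(p + M).toNat, by omega⟩
    simp only [code, Prod.mk.injEq, decide_eq_decide] at h1
    rw [show (((p + M).toNat : ℕ) : ℤ) - M = p by omega] at h1
    exact h1
  refine ext_contents ?_ ?_
  · ext p
    exact ⟨fun hp => (key p (T.contentsFst_bound hM hp)).1.1 hp,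
      fun hp => (key p (T'.contentsFst_bound hM hp)).1.2 hp⟩
  · ext p
    exact ⟨fun hp => (key p (T.contentsSnd_bound hM hp)).2.1 hp,
      fun hp => (key p (T'.contentsSnd_bound hM hp)).2.2 hp⟩

instance : Finite (TwoStep (m + 1) α γ) := by
  obtain ⟨M, hM⟩ := exists_dlen_eq_zero γ
  exact Finite.of_injective _ (code_injective hM)

noncomputable instance : Fintype (TwoStep (m + 1) α γ) := Fintype.ofFinite _

variable {K : Type*} [CommRing K]

/-- Site `i` stands for content `i - M`. The powers of `x` and `y` count departures, one per ribbon;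
the power of `t` counts beads in flight over occupied sites, which `Strip.sum_height_eq` identifies
with twice the spin. -/
theorem pathWeight_code (x y t : K) {M : ℕ} (hM : ∀ d : ℤ, (d ≤ -M ∨ M ≤ d) → dlen γ d = 0)
    (T : TwoStep (m + 1) α γ) :
    pathWeight x y t (2 * M) (fun i => boolBit α (i - M)) (fun i => boolBit γ (i - M))
      (fun _ : Fin (m + 1) => (false, false)) (code M T) =
    x ^ T.fst.card * y ^ T.snd.card * t ^ T.height := by
  have hk : 1 ≤ m + 1 := Nat.le_add_left _ _
  set S := T.contentsFst with hS
  set S' := T.contentsSnd with hS'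
  have hb := fun p hp => T.contentsFst_bound hM (p := p) hp
  have hb' := fun p hp => T.contentsSnd_bound hM (p := p) hp
  rw [← hS] at hb
  rw [← hS'] at hb'
  let h : ℕ → Bool × Bool := fun i =>
    (decide ((i : ℤ) - M - (m + 1 : ℕ) ∈ S), decide ((i : ℤ) - M - (m + 1 : ℕ) ∈ S'))
  have hσ : (fun _ : Fin (m + 1) => (false, false)) = fun i : Fin (m + 1) => h i := by
    funext i
    have := i.2
    have e : (i : ℤ) - M - (m + 1 : ℕ) ∉ S := fun h => by have := hb _ h; omega
    have e' : (i : ℤ) - M - (m + 1 : ℕ) ∉ S' := fun h => by have := hb' _ h; omega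
    simp only [h, e, e', decide_false]
  have hout : ∀ i : ℕ, h (i + (m + 1)) = (decide ((i : ℤ) - M ∈ S), decide ((i : ℤ) - M ∈ S')) := by
    intro i
    simp only [h]
    rw [show ((i + (m + 1) : ℕ) : ℤ) - M - (m + 1 : ℕ) = i - M by push_cast; ring]
  have hg : code M T = fun i : Fin (2 * M) => h (m + 1 + i) := by
    funext i
    rw [add_comm (m + 1), hout]
    rfl
  have hfin : ∀ i < m + 1, h (2 * M + i) = (false, false) := by
    intro i hi
    have e : ((2 * M + i : ℕ) : ℤ) - M - (m + 1 : ℕ) ∉ S := fun h => by have := hb _ h; omega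
    have e' : ((2 * M + i : ℕ) : ℤ) - M - (m + 1 : ℕ) ∉ S' := fun h => by have := hb' _ h; omega
    simp only [h, e, e', decide_false]
  have hN : ∀ (S : Finset ℤ) (i : ℕ),
      ∑ j ∈ Finset.range m, (decide (((i + 1 + j : ℕ) : ℤ) - M - (m + 1 : ℕ) ∈ S)).toNat =
      (S.filter fun p => (i : ℤ) - M - (m + 1 : ℕ) < p ∧ p < i - M).card := by
    intro S i
    have h1 := sum_range_mem S ((i : ℤ) - M - (m + 1 : ℕ)) m
    rw [show (i : ℤ) - M - (m + 1 : ℕ) + 1 + m = i - M by push_cast; ring] at h1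
    rw [← h1]
    refine Finset.sum_congr rfl fun j _ => ?_
    rw [show ((i + 1 + j : ℕ) : ℤ) - M - (m + 1 : ℕ) = i - M - (m + 1 : ℕ) + 1 + j by
      push_cast; ring]
  rw [hσ, hg, pathWeight_eq_prod, if_pos hfin, mul_one]
  -- The occupation of a site after a landing and before a departure, for the first strip; `u'` is
  -- the same for the second.
  let u : ℤ → ℕ := fun d => (boolBit α d).toNat + (decide (d - (m + 1 : ℕ) ∈ S)).toNat
  let u' : ℤ → ℕ := fun d => (boolBit T.mid d).toNat + (decide (d - (m + 1 : ℕ) ∈ S')).toNat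
  have hv : ∀ i : ℕ, vertexWeight x y t (boolBit α (i - M)) (boolBit γ (i - M)) (h i)
        (h (i + (m + 1))) (∑ j ∈ Finset.range m, (h (i + 1 + j)).1.toNat)
        (∑ j ∈ Finset.range m, (h (i + 1 + j)).2.toNat) =
      x ^ (decide ((i : ℤ) - M ∈ S)).toNat * y ^ (decide ((i : ℤ) - M ∈ S')).toNat *
        t ^ (u (i - M) * (S.filter fun p => (i : ℤ) - M - (m + 1 : ℕ) < p ∧ p < i - M).card +
          u' (i - M) * (S'.filter fun p => (i : ℤ) - M - (m + 1 : ℕ) < p ∧ p < i - M).card) := by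
    intro i
    obtain ⟨a1, a2, a3⟩ := T.strip_fst.toNat_eq hk (i - M)
    obtain ⟨b1, b2, b3⟩ := T.strip_snd.toNat_eq hk (i - M)
    rw [← hS] at a1 a2 a3
    rw [← hS'] at b1 b2 b3
    rw [hout, vertexWeight]
    simp only [h, hN, a3]
    rw [if_pos ⟨a1, a2, b1, by omega⟩]
  have hsum := T.strip_fst.sum_height_eq hk
  have hsum' := T.strip_snd.sum_height_eq hk
  rw [← hS] at hsum
  rw [← hS'] at hsum'
  have hu : ∑ R ∈ T.fst, (RibbonTableaux.height R - 1) =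
      ∑ p ∈ S, ∑ d ∈ Finset.Ioo p (p + (m + 1 : ℕ)), u d := by
    zify [u, decide_toNat, boolBit_toNat] at hsum ⊢
    rw [hsum]
  have hu' : ∑ R ∈ T.snd, (RibbonTableaux.height R - 1) =
      ∑ p ∈ S', ∑ d ∈ Finset.Ioo p (p + (m + 1 : ℕ)), u' d := by
    zify [u', decide_toNat, boolBit_toNat] at hsum' ⊢
    rw [hsum']
  simp only [hv]
  rw [Finset.prod_mul_distrib, Finset.prod_mul_distrib, Finset.prod_pow_eq_pow_sum,
    Finset.prod_pow_eq_pow_sum, Finset.prod_pow_eq_pow_sum, Finset.sum_add_distrib,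
    sum_mem_eq_card S M (fun p hp => ⟨(hb p hp).1, by have := hb p hp; omega⟩),
    sum_mem_eq_card S' M (fun p hp => ⟨(hb' p hp).1, by have := hb' p hp; omega⟩),
    sum_mul_card S u M _ hb, sum_mul_card S' u' M _ hb', TwoStep.height, hu, hu',
    T.strip_fst.card_eq hk, T.strip_snd.card_eq hk]

theorem bit_of_far {lam : YoungDiagram} {M : ℕ}
    (hM : ∀ d : ℤ, (d ≤ -M ∨ M ≤ d) → dlen lam d = 0) {d : ℤ} (hd : d < -M ∨ M ≤ d) :
    bit lam d = if d < 0 then 1 else 0 := by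
  rw [bit, hM d (by omega), hM (d + 1) (by omega)]
  simp

/-- A nonzero weight makes every vertex admissible, which is the local condition for a strip in each
row. Outside the window there are no legs and `α`, `γ` have the same bits, so nothing has to be
checked there. -/
theorem exists_code_eq {x y t : K} {M : ℕ} (hα : ∀ d : ℤ, (d ≤ -M ∨ M ≤ d) → dlen α d = 0)
    (hγ : ∀ d : ℤ, (d ≤ -M ∨ M ≤ d) → dlen γ d = 0) {g : Fin (2 * M) → Bool × Bool}
    (hg : pathWeight x y t (2 * M) (fun i => boolBit α (i - M)) (fun i => boolBit γ (i - M))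
      (fun _ : Fin (m + 1) => (false, false)) g ≠ 0) :
    ∃ T : TwoStep (m + 1) α γ, code M T = g := by
  have hk : 1 ≤ m + 1 := Nat.le_add_left _ _
  let H : ℤ → Bool × Bool := fun p =>
    if hp : 0 ≤ p + M ∧ p + M < 2 * M then g ⟨(p + M).toNat, by omega⟩ else (false, false)
  have hH : ∀ p : ℤ, ¬ (0 ≤ p + M ∧ p + M < 2 * (M : ℤ)) → H p = (false, false) := fun p hp => dif_neg hp
  let h : ℕ → Bool × Bool := fun i => H (i - M - (m + 1 : ℕ))
  have hσ : (fun _ : Fin (m + 1) => (false, false)) = fun i : Fin (m + 1) => h i := by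
    funext i
    have := i.2
    exact (hH _ (by omega)).symm
  have hg' : g = fun i : Fin (2 * M) => h (m + 1 + i) := by
    funext i
    simp only [h, H]
    rw [dif_pos (by have := i.2; push_cast; omega)]
    congr 1
    ext
    push_cast
    omega
  rw [hσ, hg', pathWeight_eq_prod] at hg
  have hprod := left_ne_zero_of_mul hg
  have hfin : ∀ i < m + 1, h (2 * M + i) = (false, false) := by
    by_contra hc
    exact right_ne_zero_of_mul hg (if_neg hc)
  have hout : ∀ d : ℤ, ¬ (0 ≤ d + M ∧ d + M < 2 * (M : ℤ)) → H (d - (m + 1 : ℕ)) = (false, false) := by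
    intro d hd
    -- A bead landing just right of the window would have left one of the last `m + 1` sites, which
    -- the empty final boundary forbids.
    by_cases hd' : (M : ℤ) ≤ d ∧ d < M + (m + 1 : ℕ)
    · have := hfin (d - M).toNat (by omega)
      simp only [h] at this
      rw [← this]
      congr 1
      push_cast
      omega
    · exact hH _ (by omega)
  have hcond : ∀ d : ℤ,
      (boolBit α d).toNat + (H (d - (m + 1 : ℕ))).1.toNat ≤ 1 ∧
      (H d).1.toNat ≤ (boolBit α d).toNat + (H (d - (m + 1 : ℕ))).1.toNat ∧
      (boolBit α d).toNat + (H (d - (m + 1 : ℕ))).1.toNat - (H d).1.toNat +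
        (H (d - (m + 1 : ℕ))).2.toNat ≤ 1 ∧
      (H d).2.toNat + (boolBit γ d).toNat =
        (boolBit α d).toNat + (H (d - (m + 1 : ℕ))).1.toNat - (H d).1.toNat +
        (H (d - (m + 1 : ℕ))).2.toNat := by
    intro d
    by_cases hd : 0 ≤ d + M ∧ d + M < 2 * (M : ℤ)
    · have h1 := vertexWeight_ne_zero (fun e => hprod
        (Finset.prod_eq_zero (Finset.mem_range.2 (show (d + M).toNat < 2 * M by omega)) e))
      simp only [h] at h1
      rw [show (((d + M).toNat : ℕ) : ℤ) - M = d by omega,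
        show (((d + M).toNat + (m + 1) : ℕ) : ℤ) - M - (m + 1 : ℕ) = d by push_cast; omega] at h1
      exact h1
    · have e : boolBit γ d = boolBit α d := by
        rw [boolBit, boolBit, bit_of_far hα (by omega), bit_of_far hγ (by omega)]
      rw [hH d hd, hout d hd, e]
      have := Bool.toNat_le (boolBit α d)
      simp
      omega
  let S := (Finset.Ico (-M : ℤ) M).filter fun p => (H p).1 = true
  let S' := (Finset.Ico (-M : ℤ) M).filter fun p => (H p).2 = true
  have hS : ∀ p, decide (p ∈ S) = (H p).1 := by
    intro p
    by_cases hp : 0 ≤ p + M ∧ p + M < 2 * (M : ℤ)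
    · have : -(M : ℤ) ≤ p ∧ p < M := by omega
      simp [S, this]
    · have : ¬ (-(M : ℤ) ≤ p ∧ p < M) := by omega
      simp [S, this, hH p hp]
  have hS' : ∀ p, decide (p ∈ S') = (H p).2 := by
    intro p
    by_cases hp : 0 ≤ p + M ∧ p + M < 2 * (M : ℤ)
    · have : -(M : ℤ) ≤ p ∧ p < M := by omega
      simp [S', this]
    · have : ¬ (-(M : ℤ) ≤ p ∧ p < M) := by omega
      simp [S', this, hH p hp]
  obtain ⟨β, P, hβ⟩ := Strip.exists_of_toNat hk α S fun d => by
    rw [hS, hS]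
    exact ⟨(hcond d).1, (hcond d).2.1⟩
  have hβ' : ∀ d, (boolBit α d).toNat + (H (d - (m + 1 : ℕ))).1.toNat - (H d).1.toNat =
      (boolBit β d).toNat := fun d => by
    have := (hβ.toNat_eq hk d).2.2
    rwa [hS, hS] at this
  simp only [hβ'] at hcond
  obtain ⟨δ, P', hδ⟩ := Strip.exists_of_toNat hk β S' fun d => by
    rw [hS', hS']
    have := hcond d
    omega
  obtain rfl : δ = γ := eq_of_bit fun d => by
    have h1 := (hδ.toNat_eq hk d).2.2
    rw [hS', hS'] at h1
    have h2 := hcond d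
    have h3 : (boolBit δ d).toNat = (boolBit γ d).toNat := by omega
    rw [← boolBit_toNat, ← boolBit_toNat, h3]
  refine ⟨⟨β, P, P', hβ.isHorizontalStripTiling hk, hδ.isHorizontalStripTiling hk⟩, ?_⟩
  set T : TwoStep (m + 1) α δ :=
    ⟨β, P, P', hβ.isHorizontalStripTiling hk, hδ.isHorizontalStripTiling hk⟩ with hT
  have e : T.contentsFst = S := T.strip_fst.contents_unique hβ hk
  have e' : T.contentsSnd = S' := T.strip_snd.contents_unique hδ hk
  funext i
  have h1 : H ((i : ℤ) - M) = g i := by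
    simp only [H]
    rw [dif_pos (by have := i.2; omega)]
    congr 1
    ext
    push_cast
    omega
  rw [code, e, e', hS, hS', h1]

/-- The generating function of pairs of strips is a partition function. -/
theorem sum_eq_partitionFunction (x y t : K) {M : ℕ}
    (hα : ∀ d : ℤ, (d ≤ -M ∨ M ≤ d) → dlen α d = 0)
    (hγ : ∀ d : ℤ, (d ≤ -M ∨ M ≤ d) → dlen γ d = 0) :
    ∑ T : TwoStep (m + 1) α γ, x ^ T.fst.card * y ^ T.snd.card * t ^ T.height =
      partitionFunction x y t (2 * M) (fun i => boolBit α (i - M)) (fun i => boolBit γ (i - M))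
        (fun _ : Fin (m + 1) => (false, false)) := by
  rw [partitionFunction_eq_sum_pathWeight]
  refine Fintype.sum_of_injective (code M) (code_injective hγ) _ _ ?_ ?_
  · intro g hg
    by_contra hne
    obtain ⟨T, hT⟩ := exists_code_eq hα hγ hne
    exact hg ⟨T, hT⟩
  · intro T
    exact (pathWeight_code x y t hγ T).symm

/-- The strips can be interchanged: the generating function is symmetric. -/
theorem sum_comm {y z t s : K} (hts : t * s = 1) :
    ∑ T : TwoStep (m + 1) α γ, (z * y) ^ T.fst.card * y ^ T.snd.card * t ^ T.height =
      ∑ T : TwoStep (m + 1) α γ, y ^ T.fst.card * (z * y) ^ T.snd.card * t ^ T.height := by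
  obtain ⟨M, hM⟩ := exists_dlen_eq_zero α
  obtain ⟨M', hM'⟩ := exists_dlen_eq_zero γ
  have hα : ∀ d : ℤ, (d ≤ -(M + M' : ℕ) ∨ (M + M' : ℕ) ≤ d) → dlen α d = 0 :=
    fun d hd => hM d (by push_cast at hd; omega)
  have hγ : ∀ d : ℤ, (d ≤ -(M + M' : ℕ) ∨ (M + M' : ℕ) ≤ d) → dlen γ d = 0 :=
    fun d hd => hM' d (by push_cast at hd; omega)
  rw [sum_eq_partitionFunction _ _ _ hα hγ, sum_eq_partitionFunction _ _ _ hα hγ,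
    partitionFunction_comm hts]

/-- The exponents of the monomial of a pair of strips. -/
noncomputable def exponent (T : TwoStep (m + 1) α γ) : Fin 3 → ℕ :=
  ![T.fst.card, T.snd.card, T.height]

/-- The same with the strips interchanged. -/
noncomputable def exponentSwap (T : TwoStep (m + 1) α γ) : Fin 3 → ℕ :=
  ![T.snd.card, T.fst.card, T.height]

theorem card_exponent_eq (e : Fin 3 → ℕ) :
    Fintype.card {T : TwoStep (m + 1) α γ // T.exponent = e} =
      Fintype.card {T : TwoStep (m + 1) α γ // T.exponentSwap = e} := by
  -- The symmetry needs weights of the form `z * y` and `y` and an invertible `t`. Indeterminates in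
  -- a fraction field provide both, and the resulting identity descends to polynomials.
  let A := MvPolynomial (Fin 3) ℤ
  let K := FractionRing A
  let v : Fin 3 → K := fun i => algebraMap A K (MvPolynomial.X i)
  have hv : ∀ i, v i ≠ 0 := fun i =>
    (map_ne_zero_iff _ (IsFractionRing.injective A K)).2 (MvPolynomial.X_ne_zero i)
  have h1 := sum_comm (m := m) (α := α) (γ := γ) (y := v 1) (z := v 0 / v 1)
    (mul_inv_cancel₀ (hv 2))
  rw [div_mul_cancel₀ _ (hv 1)] at h1
  have hmon : ∀ f : Fin 3 → ℕ, v 0 ^ f 0 * v 1 ^ f 1 * v 2 ^ f 2 =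
      algebraMap A K (MvPolynomial.monomial (Finsupp.equivFunOnFinite.symm f) 1) := by
    intro f
    rw [MvPolynomial.monomial_eq, Finsupp.prod_fintype _ _ (fun i => pow_zero _)]
    simp [v, Fin.prod_univ_three]
  have h2 : ∑ T : TwoStep (m + 1) α γ,
        (MvPolynomial.monomial (Finsupp.equivFunOnFinite.symm T.exponent) 1 : A) =
      ∑ T : TwoStep (m + 1) α γ,
        MvPolynomial.monomial (Finsupp.equivFunOnFinite.symm T.exponentSwap) 1 := by
    apply IsFractionRing.injective A K
    rw [map_sum, map_sum]
    simp only [← hmon]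
    refine h1.trans (Finset.sum_congr rfl fun T _ => ?_)
    simp only [exponentSwap, Matrix.cons_val_zero, Matrix.cons_val_one, Matrix.cons_val]
    ring
  have h3 := congrArg (MvPolynomial.coeff (Finsupp.equivFunOnFinite.symm e)) h2
  rw [MvPolynomial.coeff_sum, MvPolynomial.coeff_sum] at h3
  simp only [MvPolynomial.coeff_monomial, EmbeddingLike.apply_eq_iff_eq, Finset.sum_boole] at h3
  rw [Fintype.card_subtype, Fintype.card_subtype]
  exact_mod_cast h3

/-- A bijection between pairs of strips that interchanges their weights and preserves the spin. -/
theorem exists_equiv (k : ℕ) (hk : 1 ≤ k) (α γ : YoungDiagram) :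
    ∃ E : TwoStep k α γ ≃ TwoStep k α γ, ∀ T, (E T).fst.card = T.snd.card ∧
      (E T).snd.card = T.fst.card ∧ (E T).height = T.height := by
  obtain ⟨m, rfl⟩ := Nat.exists_eq_add_of_le' hk
  have h1 : ∀ e : Fin 3 → ℕ, Nonempty ({T : TwoStep (m + 1) α γ // T.exponentSwap = e} ≃
      {T : TwoStep (m + 1) α γ // T.exponent = e}) := fun e =>
    Fintype.card_eq.1 (card_exponent_eq e).symm
  -- Each fibre of `exponentSwap` is matched with the equinumerous fibre of `exponent`.
  let E : TwoStep (m + 1) α γ ≃ TwoStep (m + 1) α γ :=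
    (Equiv.sigmaFiberEquiv exponentSwap).symm.trans
      ((Equiv.sigmaCongrRight fun e => (h1 e).some).trans (Equiv.sigmaFiberEquiv exponent))
  have hE : ∀ T, (E T).exponent = T.exponentSwap := fun T =>
    ((h1 T.exponentSwap).some ⟨T, rfl⟩).2
  refine ⟨E, fun T => ⟨congrFun (hE T) 0, congrFun (hE T) 1, congrFun (hE T) 2⟩⟩

end TwoStep

/-! ### Exchanging adjacent strips of a tableau -/

/-- The conditions on the data of two consecutive horizontal ribbon strips. -/
def IsTwoStep (k : ℕ) (α γ : YoungDiagram)
    (x : YoungDiagram × Finset (Finset Cell) × Finset (Finset Cell)) : Prop :=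
  IsHorizontalStripTiling k α x.1 x.2.1 ∧ IsHorizontalStripTiling k x.1 γ x.2.2

/-- The properties of an exchange of the weights of two strips. -/
def IsExchange (k : ℕ) (α γ : YoungDiagram)
    (e : YoungDiagram × Finset (Finset Cell) × Finset (Finset Cell) →
      YoungDiagram × Finset (Finset Cell) × Finset (Finset Cell)) : Prop :=
  ∀ x, IsTwoStep k α γ x → IsTwoStep k α γ (e x) ∧ (e x).2.1.card = x.2.2.card ∧
    (e x).2.2.card = x.2.1.card ∧
    ∑ R ∈ (e x).2.1, (height R - 1) + ∑ R ∈ (e x).2.2, (height R - 1) =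
      ∑ R ∈ x.2.1, (height R - 1) + ∑ R ∈ x.2.2, (height R - 1)

theorem exists_isExchange {k : ℕ} (hk : 1 ≤ k) (α γ : YoungDiagram) :
    ∃ e : Equiv.Perm (YoungDiagram × Finset (Finset Cell) × Finset (Finset Cell)),
      IsExchange k α γ e ∧ IsExchange k α γ e.symm := by
  classical
  obtain ⟨E, hE⟩ := TwoStep.exists_equiv k hk α γ
  let f : TwoStep k α γ ≃ Subtype (IsTwoStep k α γ) :=
    { toFun := fun T => ⟨(T.mid, T.fst, T.snd), T.tiling_fst, T.tiling_snd⟩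
      invFun := fun x => ⟨x.1.1, x.1.2.1, x.1.2.2, x.2.1, x.2.2⟩
      left_inv := fun _ => rfl
      right_inv := fun _ => rfl }
  -- Extension by the identity to all triples frees the data of a modified tableau from proofs.
  refine ⟨Equiv.Perm.extendDomain E f, fun x hx => ?_, fun x hx => ?_⟩
  · have h1 := Equiv.Perm.extendDomain_apply_image E f (f.symm ⟨x, hx⟩)
    rw [Equiv.apply_symm_apply] at h1
    dsimp only at h1
    rw [h1]
    exact ⟨(f _).2, hE (f.symm ⟨x, hx⟩)⟩
  · have h1 := Equiv.Perm.extendDomain_apply_image (Equiv.symm E) f (f.symm ⟨x, hx⟩)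
    rw [Equiv.apply_symm_apply] at h1
    dsimp only at h1
    rw [Equiv.Perm.extendDomain_symm, h1]
    have h2 := hE (E.symm (f.symm ⟨x, hx⟩))
    rw [Equiv.apply_symm_apply] at h2
    exact ⟨(f _).2, h2.2.1.symm, h2.1.symm, h2.2.2.symm⟩

namespace Tab

variable {k : ℕ} {lam : YoungDiagram} {μ μ' : ℕ →₀ ℕ}

theorem spin_eq_sum_range (T : Tab k lam μ) {N : ℕ} (hN : ∀ i, N ≤ i → μ i = 0) :
    T.spin = ((∑ i ∈ Finset.range N, ∑ R ∈ T.ribbons i, (height R - 1) : ℕ) : ℚ) / 2 := by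
  rw [T.spin_eq]
  congr 2
  refine Finset.sum_subset (fun i hi => ?_) (fun i _ hi => ?_)
  · rw [Finset.mem_range]
    by_contra h
    exact (Finsupp.mem_support_iff.1 hi) (hN i (not_lt.1 h))
  · rw [T.ribbons_eq_empty (by simpa using hi), Finset.sum_empty]

/-- `μ'` arises from `μ` by exchanging the entries `i` and `i + 1`. -/
structure IsSwap (i : ℕ) (μ μ' : ℕ →₀ ℕ) : Prop where
  left : μ' i = μ (i + 1)
  right : μ' (i + 1) = μ i
  other : ∀ j, j ≠ i → j ≠ i + 1 → μ' j = μ j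

theorem IsSwap.symm {i : ℕ} (h : IsSwap i μ μ') : IsSwap i μ' μ :=
  ⟨h.right.symm, h.left.symm, fun j h1 h2 => (h.other j h1 h2).symm⟩

theorem isTwoStep (T : Tab k lam μ) (i : ℕ) : IsTwoStep k (T.chain i) (T.chain (i + 1 + 1))
    (T.chain (i + 1), T.ribbons i, T.ribbons (i + 1)) :=
  ⟨T.strip i, T.strip (i + 1)⟩

/-- The data of the strips `i` and `i + 1` of a tableau after an exchange. -/
def exchanged (e : YoungDiagram → YoungDiagram →
      YoungDiagram × Finset (Finset Cell) × Finset (Finset Cell) →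
      YoungDiagram × Finset (Finset Cell) × Finset (Finset Cell)) (i : ℕ) (T : Tab k lam μ) :
    YoungDiagram × Finset (Finset Cell) × Finset (Finset Cell) :=
  e (T.chain i) (T.chain (i + 1 + 1)) (T.chain (i + 1), T.ribbons i, T.ribbons (i + 1))

theorem exchanged_spec {e : YoungDiagram → YoungDiagram →
      YoungDiagram × Finset (Finset Cell) × Finset (Finset Cell) →
      YoungDiagram × Finset (Finset Cell) × Finset (Finset Cell)}
    (he : ∀ α γ, IsExchange k α γ (e α γ)) (i : ℕ) (T : Tab k lam μ) :
    IsTwoStep k (T.chain i) (T.chain (i + 1 + 1)) (T.exchanged e i) ∧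
      (T.exchanged e i).2.1.card = μ (i + 1) ∧ (T.exchanged e i).2.2.card = μ i ∧
      ∑ R ∈ (T.exchanged e i).2.1, (height R - 1) + ∑ R ∈ (T.exchanged e i).2.2, (height R - 1) =
      ∑ R ∈ T.ribbons i, (height R - 1) + ∑ R ∈ T.ribbons (i + 1), (height R - 1) := by
  rw [← T.weight, ← T.weight]
  exact he _ _ _ (T.isTwoStep i)

/-- The tableau obtained by exchanging the strips `i` and `i + 1`. -/
def exchange (e : YoungDiagram → YoungDiagram →
      YoungDiagram × Finset (Finset Cell) × Finset (Finset Cell) →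
      YoungDiagram × Finset (Finset Cell) × Finset (Finset Cell))
    (he : ∀ α γ, IsExchange k α γ (e α γ)) {i : ℕ} (hs : IsSwap i μ μ') (T : Tab k lam μ) :
    Tab k lam μ' where
  chain j := if j = i + 1 then (T.exchanged e i).1 else T.chain j
  ribbons j := if j = i then (T.exchanged e i).2.1
    else if j = i + 1 then (T.exchanged e i).2.2 else T.ribbons j
  chain_zero := by simp [T.chain_zero]
  strip j := by
    have h := (T.exchanged_spec he i).1
    by_cases h1 : j = i
    · subst h1
      simpa using h.1
    by_cases h2 : j = i + 1
    · subst h2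
      simpa using h.2
    simpa [h1, h2] using T.strip j
  weight j := by
    have h := (T.exchanged_spec he i).2
    by_cases h1 : j = i
    · subst h1
      simp only [if_true]
      rw [hs.left, h.1]
    by_cases h2 : j = i + 1
    · subst h2
      simp only [h1, if_true, if_false]
      rw [hs.right, h.2.1]
    simp only [h1, h2, if_false]
    rw [hs.other j h1 h2, T.weight]
  top := by
    obtain ⟨N, hN⟩ := T.top
    exact ⟨max N (i + 2), fun j hj => by
      rw [if_neg (by have := le_max_right N (i + 2); omega), hN j (le_of_max_le_left hj)]⟩

theorem exchange_chain {e : YoungDiagram → YoungDiagram →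
      YoungDiagram × Finset (Finset Cell) × Finset (Finset Cell) →
      YoungDiagram × Finset (Finset Cell) × Finset (Finset Cell)}
    (he : ∀ α γ, IsExchange k α γ (e α γ)) {i : ℕ} (hs : IsSwap i μ μ') (T : Tab k lam μ) (j : ℕ) :
    (T.exchange e he hs).chain j = if j = i + 1 then (T.exchanged e i).1 else T.chain j := rfl

theorem exchange_ribbons {e : YoungDiagram → YoungDiagram →
      YoungDiagram × Finset (Finset Cell) × Finset (Finset Cell) →
      YoungDiagram × Finset (Finset Cell) × Finset (Finset Cell)}
    (he : ∀ α γ, IsExchange k α γ (e α γ)) {i : ℕ} (hs : IsSwap i μ μ') (T : Tab k lam μ) (j : ℕ) :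
    (T.exchange e he hs).ribbons j = if j = i then (T.exchanged e i).2.1
      else if j = i + 1 then (T.exchanged e i).2.2 else T.ribbons j := rfl

/-- The outer partitions `T.chain i` and `T.chain (i + 1 + 1)` are kept, so the second exchange uses
the map inverse to the first. -/
theorem exchange_exchange {e e' : YoungDiagram → YoungDiagram →
      YoungDiagram × Finset (Finset Cell) × Finset (Finset Cell) →
      YoungDiagram × Finset (Finset Cell) × Finset (Finset Cell)}
    (he : ∀ α γ, IsExchange k α γ (e α γ)) (he' : ∀ α γ, IsExchange k α γ (e' α γ))
    (h : ∀ α γ x, e' α γ (e α γ x) = x) {i : ℕ} (hs : IsSwap i μ μ') (hs' : IsSwap i μ' μ)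
    (T : Tab k lam μ) : (T.exchange e he hs).exchange e' he' hs' = T := by
  have key : (T.exchange e he hs).exchanged e' i =
      (T.chain (i + 1), T.ribbons i, T.ribbons (i + 1)) := by
    rw [exchanged]
    simp only [exchange, if_true]
    simp only [show ¬ i = i + 1 by omega, show ¬ i + 1 + 1 = i + 1 by omega,
      show ¬ i + 1 = i by omega, if_false]
    exact h _ _ _
  apply Tab.ext
  · funext j
    rw [exchange_chain, key, exchange_chain]
    split_ifs with h1
    · rw [h1]
    · rfl
  · funext j
    rw [exchange_ribbons, key, exchange_ribbons]
    split_ifs with h1 h2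
    · rw [h1]
    · rw [h2]
    · rfl

theorem exchange_spin {e : YoungDiagram → YoungDiagram →
      YoungDiagram × Finset (Finset Cell) × Finset (Finset Cell) →
      YoungDiagram × Finset (Finset Cell) × Finset (Finset Cell)}
    (he : ∀ α γ, IsExchange k α γ (e α γ)) {i : ℕ} (hs : IsSwap i μ μ') (T : Tab k lam μ) :
    (T.exchange e he hs).spin = T.spin := by
  obtain ⟨N, hN⟩ := exists_bound μ
  have hN1 : ∀ j, i + 1 + 1 + N ≤ j → μ j = 0 := fun j hj => hN j (by omega)
  have hN2 : ∀ j, i + 1 + 1 + N ≤ j → μ' j = 0 := fun j hj => by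
    rw [hs.other j (by omega) (by omega), hN1 j hj]
  rw [spin_eq_sum_range _ hN1, spin_eq_sum_range _ hN2]
  congr 2
  rw [Finset.sum_range_add _ (i + 1 + 1) N, Finset.sum_range_add _ (i + 1 + 1) N, Finset.sum_range_succ, Finset.sum_range_succ,
    Finset.sum_range_succ _ (i + 1), Finset.sum_range_succ _ i]
  have h1 : ∀ j < i, (T.exchange e he hs).ribbons j = T.ribbons j := fun j hj => by
    simp only [exchange]
    rw [if_neg (by omega), if_neg (by omega)]
  have h2 : ∀ j, (T.exchange e he hs).ribbons (i + 1 + 1 + j) = T.ribbons (i + 1 + 1 + j) :=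
    fun j => by
      simp only [exchange]
      rw [if_neg (by omega), if_neg (by omega)]
  have h3 : (T.exchange e he hs).ribbons i = (T.exchanged e i).2.1 := by simp [exchange]
  have h4 : (T.exchange e he hs).ribbons (i + 1) = (T.exchanged e i).2.2 := by simp [exchange]
  have h := (T.exchanged_spec he i).2.2.2
  rw [Finset.sum_congr rfl fun j hj => by rw [h1 j (Finset.mem_range.1 hj)],
    Finset.sum_congr (s₁ := Finset.range N) rfl fun j _ => by rw [h2 j], h3, h4]
  omega

/-- Exchanging two adjacent entries of the weight does not change the distribution of the spin. -/
theorem exists_equiv_of_isSwap (hk : 1 ≤ k) {i : ℕ} (hs : IsSwap i μ μ') :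
    ∃ F : Tab k lam μ ≃ Tab k lam μ', ∀ T, (F T).spin = T.spin := by
  choose e he he' using fun α γ => exists_isExchange hk α γ
  exact ⟨{ toFun := exchange (fun α γ => e α γ) he hs
           invFun := exchange (fun α γ => (e α γ).symm) he' hs.symm
           left_inv := exchange_exchange he he' (fun α γ x => (e α γ).symm_apply_apply x) hs hs.symm
           right_inv := exchange_exchange he' he (fun α γ x => (e α γ).apply_symm_apply x) hs.symm hs },
    exchange_spin he hs⟩

end Tab

/-! ### From adjacent transpositions to symmetric functions -/

/-- Invariance under exchanges of adjacent entries implies invariance under all permutations. -/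
theorem mapDomain_invariant {A : Type*} (F : (ℕ →₀ ℕ) → A)
    (hF : ∀ i μ μ', Tab.IsSwap i μ μ' → F μ' = F μ) (σ : Equiv.Perm ℕ) (d : ℕ →₀ ℕ) :
    F (Finsupp.mapDomain σ d) = F d := by
  let G : Equiv.Perm ℕ → Prop := fun τ => ∀ d, F (Finsupp.mapDomain τ d) = F d
  have hmul : ∀ τ τ', G τ → G τ' → G (τ * τ') := by
    intro τ τ' h h' d
    rw [Equiv.Perm.coe_mul, Finsupp.mapDomain_comp, h, h']
  have hadj : ∀ i, G (Equiv.swap i (i + 1)) := by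
    intro i d
    refine hF i _ _ ⟨?_, ?_, fun j h1 h2 => ?_⟩ <;> rw [Finsupp.mapDomain_equiv_apply]
    · simp
    · simp
    · rw [Equiv.symm_swap, Equiv.swap_apply_of_ne_of_ne h1 h2]
  have hlt : ∀ n a, G (Equiv.swap a (a + 1 + n)) := by
    intro n a
    induction n with
    | zero => exact hadj a
    | succ n ih =>
      -- A longer transposition is the conjugate of a shorter one by an adjacent one.
      have h := Equiv.swap_mul_swap_mul_swap (x := a) (y := a + 1 + n) (z := a + 1 + n + 1)
        (by omega) (by omega)
      rw [show a + 1 + (n + 1) = a + 1 + n + 1 by ring, Equiv.swap_comm a, ← h]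
      exact hmul _ _ (hmul _ _ (hadj _) ih) (hadj _)
  have hswap : ∀ a b, G (Equiv.swap a b) := by
    intro a b
    rcases lt_trichotomy a b with h | rfl | h
    · have := hlt (b - (a + 1)) a
      rwa [show a + 1 + (b - (a + 1)) = b by omega] at this
    · intro d
      simp
    · have := hlt (a - (b + 1)) b
      rw [show b + 1 + (a - (b + 1)) = a by omega] at this
      rwa [Equiv.swap_comm]
  -- `σ` may move infinitely many indices, but only its values on the finite support of `d` matter,
  -- and there a product of transpositions imitates it.
  have hex : ∀ s : Finset ℕ, ∃ τ, G τ ∧ ∀ x ∈ s, τ x = σ x := by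
    intro s
    induction s using Finset.induction_on with
    | empty => exact ⟨1, fun d => by simp [Equiv.Perm.coe_one], by simp⟩
    | insert a s ha ih =>
      obtain ⟨τ, h1, h2⟩ := ih
      refine ⟨Equiv.swap (τ a) (σ a) * τ, hmul _ _ (hswap _ _) h1, fun x hx => ?_⟩
      rw [Equiv.Perm.mul_apply]
      rcases Finset.mem_insert.1 hx with rfl | hx
      · exact Equiv.swap_apply_left _ _
      · have hne : x ≠ a := fun e => ha (e ▸ hx)
        rw [Equiv.swap_apply_of_ne_of_ne, h2 x hx]
        · exact fun e => hne (τ.injective e)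
        · rw [h2 x hx]
          exact fun e => hne (σ.injective e)
  obtain ⟨τ, h1, h2⟩ := hex d.support
  rw [← h1 d]
  exact congrArg F (Finsupp.mapDomain_congr fun x hx => (h2 x hx).symm)

theorem Tab.degree_le {k : ℕ} {lam : YoungDiagram} {μ : ℕ →₀ ℕ} (T : Tab k lam μ) :
    μ.degree ≤ lam.card := by
  have step : ∀ i, μ i + (T.chain i).card ≤ (T.chain (i + 1)).card := by
    intro i
    have h1 : ∑ R ∈ T.ribbons i, 1 ≤ ∑ R ∈ T.ribbons i, (id R).card := by
      refine Finset.sum_le_sum fun R hR => ?_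
      obtain ⟨a, ha, -⟩ := (T.strip i).initial R hR
      exact Finset.card_pos.2 ⟨a, ha.1⟩
    rw [← Finset.card_biUnion (T.strip i).disjoint, (T.strip i).cover, Finset.sum_const,
      T.weight, smul_eq_mul, mul_one] at h1
    have h2 := Finset.card_sdiff_add_card_eq_card
      (YoungDiagram.cells_subset_iff.2 (T.strip i).le)
    simp only [YoungDiagram.card] at *
    omega
  have tel : ∀ n, ∑ i ∈ Finset.range n, μ i ≤ (T.chain n).card := by
    intro n
    induction n with
    | zero => simp
    | succ n ih =>
      rw [Finset.sum_range_succ]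
      have := step n
      omega
  obtain ⟨N, hN⟩ := exists_bound μ
  rw [← T.chain_eq hN le_rfl]
  refine le_trans ?_ (tel N)
  rw [Finsupp.degree_apply]
  refine Finset.sum_le_sum_of_subset fun i hi => ?_
  rw [Finset.mem_range]
  by_contra h
  exact (Finsupp.mem_support_iff.1 hi) (hN i (not_lt.1 h))

/-- Sums over ribbon tableaux of functions of the spin are symmetric functions. -/
theorem isSymmetricFunction_of_spin {k : ℕ} (hk : 1 ≤ k) (lam : YoungDiagram) (φ : ℚ → QRing)
    (f : MvPowerSeries ℕ QRing) (hf : ∀ μ, f μ = ∑ᶠ T : Tab k lam μ, φ T.spin) :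
    IsSymmetricFunction f := by
  constructor
  · refine ⟨lam.card, fun d hd => ?_⟩
    rw [MvPowerSeries.coeff_apply, hf] at hd
    by_contra hlt
    have : IsEmpty (Tab k lam d) := ⟨fun T => hlt T.degree_le⟩
    exact hd (finsum_of_isEmpty _)
  · intro σ
    have hinv := mapDomain_invariant f (fun i μ μ' hs => by
      obtain ⟨F, hF⟩ := Tab.exists_equiv_of_isSwap (lam := lam) hk hs
      rw [hf, hf, ← finsum_comp_equiv F]
      simp only [hF]) σ
    refine MvPowerSeries.ext fun d => ?_
    have h1 := MvPowerSeries.coeff_embDomain_rename σ.toEmbedding f (Finsupp.mapDomain σ.symm d)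
    have h2 : Finsupp.embDomain σ.toEmbedding (Finsupp.mapDomain σ.symm d) = d := by
      rw [Finsupp.embDomain_eq_mapDomain]
      change Finsupp.mapDomain σ (Finsupp.mapDomain σ.symm d) = d
      rw [← Finsupp.mapDomain_comp]
      simp
    rw [h2] at h1
    have h3 := hinv (Finsupp.mapDomain σ.symm d)
    rw [← Finsupp.mapDomain_comp] at h3
    simp only [Equiv.self_comp_symm, Finsupp.mapDomain_id] at h3
    exact h1.trans h3.symm

/-! ### Parity of twice the spin -/

section Parity

/-- Pairs of beads that are out of order with respect to their residues modulo `k`. -/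
def inv (k : ℕ) (a b : ℤ) : ZMod 2 := if a < b ∧ b % k < a % k then 1 else 0

/-- The parity of the number of inversions among the beads in `[-M, M)`. -/
noncomputable def parity (k M : ℕ) (lam : YoungDiagram) : ZMod 2 :=
  ∑ a ∈ Finset.Ico (-M : ℤ) M, ∑ b ∈ Finset.Ico (-M : ℤ) M,
    inv k a b * ((bit lam a : ZMod 2) * (bit lam b : ZMod 2))

/-- Since `p` and `p + k` have the same residue, only the order relative to `b` can change. It flips
exactly for `b` strictly between, where the residues differ, so one inversion is gained or lost. -/
theorem inv_sub_inv {k : ℕ} (hk : 1 ≤ k) (p b : ℤ) :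
    inv k (p + k) b - inv k p b + (inv k b (p + k) - inv k b p) =
      if p < b ∧ b < p + k then 1 else 0 := by
  have h1 : (p + k) % (k : ℤ) = p % k := Int.add_emod_right _ _
  have h2 : p < b → b < p + k → b % (k : ℤ) ≠ p % k := by
    intro h3 h4 h5
    have h6 : (k : ℤ) ∣ b - p := Int.dvd_of_emod_eq_zero (Int.emod_eq_emod_iff_emod_sub_eq_zero.1 h5)
    have := Int.le_of_dvd (by omega) h6
    omega
  have h3 : b = p ∨ b = p + k → b % (k : ℤ) = p % k := by
    rintro (rfl | rfl)
    · rfl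
    · exact h1
  simp only [inv, h1]
  generalize b % (k : ℤ) = x at *
  generalize p % (k : ℤ) = y at *
  split_ifs <;> first | decide | (exfalso; omega)

theorem AddRibbon.parity_eq {k M : ℕ} {p : ℤ} {α β : YoungDiagram} (h : AddRibbon k p α β)
    (hk : 1 ≤ k) (hM : ∀ d : ℤ, (d ≤ -M ∨ M ≤ d) → dlen β d = 0) :
    parity k M β = parity k M α + (height (β.cells \ α.cells) - 1 : ℕ) := by
  have hp1 : -(M : ℤ) ≤ p := by
    by_contra! hlt
    have h1 := h (p + 1)
    rw [hM _ (by omega), if_pos ⟨by omega, by omega⟩] at h1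
    omega
  have hp2 : p + k < M := by
    by_contra! hlt
    have h1 := h (p + k)
    rw [hM _ (by omega), if_pos ⟨by omega, by omega⟩] at h1
    omega
  set s := Finset.Ico (-M : ℤ) M with hs
  set e : ℤ → ZMod 2 := fun d => (bit α d : ZMod 2) with he
  let δ : ℤ → ZMod 2 := fun d => (if d = p + k then 1 else 0) - if d = p then 1 else 0
  have hδ : ∀ f : ℤ → ZMod 2, ∑ a ∈ s, δ a * f a = f (p + k) - f p := by
    intro f
    simp only [δ, sub_mul, ite_mul, one_mul, zero_mul, Finset.sum_sub_distrib, Finset.sum_ite_eq']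
    rw [if_pos (Finset.mem_Ico.2 ⟨by omega, by omega⟩), if_pos (Finset.mem_Ico.2 ⟨by omega, by omega⟩)]
  have hbit : ∀ d, (bit β d : ZMod 2) = e d + δ d := by
    intro d
    rw [h.bit_eq hk]
    simp only [δ, he]
    push_cast
    ring
  have hheight : ((height (β.cells \ α.cells) - 1 : ℕ) : ZMod 2) =
      ∑ d ∈ Finset.Ioo p (p + k), e d := by
    have := congrArg (Int.cast : ℤ → ZMod 2) (h.height_eq hk)
    rw [Int.cast_natCast, Int.cast_sum] at this
    exact this
  -- The parity is a quadratic form in the bits, expanded here at `e + δ`; its part quadratic in `δ`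
  -- vanishes because `p` and `p + k` are congruent.
  have hexp : parity k M β = parity k M α + ∑ a ∈ s, δ a * (∑ b ∈ s, inv k a b * e b) +
      ∑ b ∈ s, δ b * (∑ a ∈ s, inv k a b * e a) + ∑ a ∈ s, δ a * ∑ b ∈ s, δ b * inv k a b := by
    have hc : ∑ b ∈ s, δ b * (∑ a ∈ s, inv k a b * e a) =
        ∑ a ∈ s, ∑ b ∈ s, δ b * (inv k a b * e a) := by
      simp only [Finset.mul_sum]
      exact Finset.sum_comm
    rw [hc]
    simp only [parity, hbit, Finset.mul_sum, ← Finset.sum_add_distrib, ← hs]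
    refine Finset.sum_congr rfl fun a _ => Finset.sum_congr rfl fun b _ => ?_
    simp only [he]
    ring
  rw [hexp, hδ, hδ, hδ, hδ, hδ, hheight, ← Finset.sum_sub_distrib, ← Finset.sum_sub_distrib,
    add_assoc (parity k M α), ← Finset.sum_add_distrib]
  have h0 : inv k (p + k) (p + k) - inv k (p + k) p - (inv k p (p + k) - inv k p p) = 0 := by
    simp [inv]
  rw [h0, add_zero]
  congr 1
  have hsub : Finset.Ioo p (p + k) = s.filter fun b => p < b ∧ b < p + k := by
    ext b
    simp only [Finset.mem_Ioo, Finset.mem_filter, hs, Finset.mem_Ico]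
    omega
  rw [hsub, Finset.sum_filter]
  refine Finset.sum_congr rfl fun b _ => ?_
  have := inv_sub_inv hk p b
  rw [← sub_mul, ← sub_mul, ← add_mul, this]
  simp

theorem Strip.parity_eq {k M : ℕ} {α β : YoungDiagram} {S : Finset ℤ} {P : Finset (Finset Cell)}
    (h : Strip k α β S P) (hk : 1 ≤ k) (hM : ∀ d : ℤ, (d ≤ -M ∨ M ≤ d) → dlen β d = 0) :
    parity k M β = parity k M α + (∑ R ∈ P, (height R - 1) : ℕ) := by
  induction h with
  | nil => simp
  | @snoc β γ S P q hs hq ha ih =>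
    have hM' : ∀ d : ℤ, (d ≤ -M ∨ M ≤ d) → dlen β d = 0 := fun d hd => by
      have := le_iff_dlen.1 ha.le d
      rw [hM d hd] at this
      omega
    rw [ha.parity_eq hk hM, ih hM', Finset.sum_insert (hs.ribbon_notMem ha hk)]
    push_cast
    ring

theorem Tab.parity_eq {k M : ℕ} {lam : YoungDiagram} {μ : ℕ →₀ ℕ} (T : Tab k lam μ) (hk : 1 ≤ k)
    (hM : ∀ d : ℤ, (d ≤ -M ∨ M ≤ d) → dlen lam d = 0) :
    ∃ n : ℕ, T.spin = n / 2 ∧ parity k M lam = parity k M ⊥ + n := by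
  obtain ⟨N, hN⟩ := exists_bound μ
  refine ⟨_, T.spin_eq_sum_range hN, ?_⟩
  have key : ∀ n, parity k M (T.chain n) = parity k M ⊥ +
      (∑ i ∈ Finset.range n, ∑ R ∈ T.ribbons i, (height R - 1) : ℕ) := by
    intro n
    induction n with
    | zero => simp [T.chain_zero]
    | succ n ih =>
      obtain ⟨S, hS⟩ := (T.strip n).exists_strip hk
      have hM' : ∀ d : ℤ, (d ≤ -M ∨ M ≤ d) → dlen (T.chain (n + 1)) d = 0 := fun d hd => by
        have := le_iff_dlen.1 (T.chain_le (n + 1)) d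
        rw [hM d hd] at this
        omega
      rw [hS.parity_eq hk hM', ih, Finset.sum_range_succ]
      push_cast
      ring
  have := key N
  rwa [T.chain_eq hN le_rfl] at this

theorem mem_stretch {k : ℕ} (hk : 1 ≤ k) {ν : YoungDiagram} {c : Cell} :
    c ∈ stretch k ν ↔ (c.1, c.2 / k) ∈ ν := by
  have h : c ∈ stretch k ν ↔ (c.1, c.2) ∈ stretch k ν := Iff.rfl
  rw [h, YoungDiagram.mem_iff_lt_rowLen, YoungDiagram.mem_iff_lt_rowLen, rowLen_stretch,
    Nat.div_lt_iff_lt_mul (by omega), mul_comm]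

/-- Removing a corner of `ν` removes from the stretched shape `k` cells of one row, a ribbon of
height one, and this leaves the parity unchanged. -/
theorem parity_stretch {k : ℕ} (hk : 1 ≤ k) (M : ℕ) (ν : YoungDiagram)
    (hM : ∀ d : ℤ, (d ≤ -M ∨ M ≤ d) → dlen (stretch k ν) d = 0) :
    parity k M (stretch k ν) = parity k M ⊥ := by
  induction hn : ν.card generalizing ν with
  | zero =>
    have h1 : ν.cells = ∅ := Finset.card_eq_zero.1 hn
    congr 1
    ext c
    rw [YoungDiagram.mem_cells, mem_stretch hk, ← YoungDiagram.mem_cells, h1]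
    simp
  | succ n ih =>
    -- A cell with maximal coordinate sum is a corner.
    obtain ⟨⟨i, j⟩, hc, hmax⟩ := Finset.exists_max_image ν.cells (fun c => c.1 + c.2)
      (Finset.card_pos.1 (by rw [YoungDiagram.card] at hn; omega))
    let ν' : YoungDiagram :=
      { cells := ν.cells.erase (i, j)
        isLowerSet := by
          intro c c' hle h
          rw [Finset.mem_coe, Finset.mem_erase] at h ⊢
          refine ⟨?_, ν.isLowerSet hle h.2⟩
          rintro rfl
          have h1 := hmax c h.2
          have h2 := hle.1
          have h3 := hle.2
          dsimp only at h1 h2 h3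
          exact h.1 (Prod.ext (by dsimp only; omega) (by dsimp only; omega)) }
    have hmem : ∀ c, c ∈ ν' ↔ c ≠ (i, j) ∧ c ∈ ν := fun c => by
      rw [← YoungDiagram.mem_cells]
      simp only [ν', Finset.mem_erase, YoungDiagram.mem_cells]
    have hle : stretch k ν' ≤ stretch k ν := fun c h =>
      (mem_stretch hk).2 ((hmem _).1 ((mem_stretch hk).1 h)).2
    -- The removed cells are in row `i` and columns `k * j, …, k * j + k - 1`, so their contents
    -- start at `k * j - i`.
    have hrib : IsRibbonAt k (k * j - i - 1) (fun _ => i)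
        ((stretch k ν).cells \ (stretch k ν').cells) := by
      refine ⟨fun d h1 _ => ?_, fun c => ?_, fun _ _ _ => Or.inl rfl⟩
      · have : (0 : ℤ) ≤ k * j := by positivity
        omega
      · rw [Finset.mem_sdiff, YoungDiagram.mem_cells, YoungDiagram.mem_cells, mem_stretch hk,
          mem_stretch hk, hmem, content]
        have h1 : ((c.1, c.2 / k) ∈ ν ∧ ¬ ((c.1, c.2 / k) ≠ (i, j) ∧ (c.1, c.2 / k) ∈ ν)) ↔
            c.1 = i ∧ c.2 / k = j := by
          constructor
          · rintro ⟨h1, h2⟩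
            by_contra h3
            exact h2 ⟨fun e => h3 (Prod.mk.inj e), h1⟩
          · rintro ⟨h1, h2⟩
            rw [h1, h2]
            exact ⟨hc, fun h => h.1 rfl⟩
        have h2 : c.2 / k = j ↔ k * j ≤ c.2 ∧ c.2 < k * j + k := by
          rw [Nat.div_eq_iff (by omega), mul_comm j k]
          omega
        rw [h1, h2]
        zify
        constructor
        · rintro ⟨e1, e2, e3⟩
          exact ⟨by omega, by omega, e1⟩
        · rintro ⟨e1, e2, e3⟩
          exact ⟨e3, by omega, by omega⟩
    have hadd := AddRibbon.of_isRibbonAt hle hrib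
    have hM' : ∀ d : ℤ, (d ≤ -M ∨ M ≤ d) → dlen (stretch k ν') d = 0 := fun d hd => by
      have := le_iff_dlen.1 hle d
      rw [hM d hd] at this
      omega
    have hcard : ν'.card = n := by
      have : (ν.cells.erase (i, j)).card = ν.cells.card - 1 := Finset.card_erase_of_mem hc
      simp only [YoungDiagram.card] at hn ⊢
      simp only [ν']
      omega
    rw [hadd.parity_eq hk hM, hrib.height_eq hk, ih ν' hM' hcard]
    simp

end Parity

/-! ### Integrality of spins and cospins, and symmetry -/

theorem Tab.exists_cospin_eq {k : ℕ} (hk : 1 ≤ k) {lam : YoungDiagram} {w : ℕ →₀ ℕ}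
    (T : Tab k lam w) : ∃ n : ℕ, T.cospin = n := by
  obtain ⟨M, hM⟩ := exists_dlen_eq_zero lam
  obtain ⟨⟨μ, T', hT'⟩, hmax⟩ := isGreatest_maxSpin (k := k) (lam := lam) ⟨_, w, T, rfl⟩
  obtain ⟨n, h1, h2⟩ := T.parity_eq hk hM
  obtain ⟨n', h1', h2'⟩ := T'.parity_eq hk hM
  have hle : T.spin ≤ maxSpin k lam := hmax ⟨w, T, rfl⟩
  rw [← hT', h1, h1'] at hle
  have hle' : n ≤ n' := by
    have : (n : ℚ) ≤ n' := by linarith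
    exact_mod_cast this
  -- Twice the spins of `T` and of a tableau of maximal spin both equal the parity of the shape
  -- relative to the empty partition.
  have hmod : n ≡ n' [MOD 2] := by
    rw [← ZMod.natCast_eq_natCast_iff]
    exact add_left_cancel (h2.symm.trans h2')
  obtain ⟨c, hc⟩ := (Nat.modEq_iff_dvd' hle').1 hmod
  refine ⟨c, ?_⟩
  have hc' : (n' : ℚ) = n + 2 * c := by
    have : n' = n + 2 * c := by omega
    exact_mod_cast this
  rw [Tab.cospin, ← hT', h1, h1', hc']
  ring

theorem Tab.exists_spin_eq {k : ℕ} (hk : 1 ≤ k) {μ : YoungDiagram} {w : ℕ →₀ ℕ}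
    (T : Tab k (stretch k μ) w) : ∃ n : ℕ, T.spin = n := by
  obtain ⟨M, hM⟩ := exists_dlen_eq_zero (stretch k μ)
  obtain ⟨n, h1, h2⟩ := T.parity_eq hk hM
  rw [parity_stretch hk M μ hM] at h2
  have h3 : (n : ZMod 2) = 0 := by simpa using h2.symm
  obtain ⟨c, rfl⟩ := (ZMod.natCast_eq_zero_iff n 2).1 h3
  refine ⟨c, ?_⟩
  rw [h1]
  push_cast
  ring

theorem isSymmetricFunction_Gtilde {k : ℕ} (hk : 1 ≤ k) (lam : YoungDiagram) :
    IsSymmetricFunction (Gtilde k lam) :=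
  -- The maximal spin depends on the shape alone, so the cospin is a function of the spin.
  isSymmetricFunction_of_spin hk lam (fun s => qpow (maxSpin k lam - s)) _ fun _ => rfl

theorem isSymmetricFunction_Hfun {k : ℕ} (hk : 1 ≤ k) (μ : YoungDiagram) :
    IsSymmetricFunction (Hfun k μ) :=
  isSymmetricFunction_of_spin hk (stretch k μ) qpow _ fun _ => rfl

end RibbonTableaux

theorem mainTheorem2 (k : ℕ) (hk : 1 ≤ k) :
    (∀ lam : YoungDiagram,
      (∀ (w : ℕ →₀ ℕ) (T : Tab k lam w), ∃ n : ℕ, T.cospin = n) ∧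
        IsSymmetricFunction (Gtilde k lam)) ∧
    (∀ μ : YoungDiagram,
      (∀ (w : ℕ →₀ ℕ) (T : Tab k (stretch k μ) w), ∃ n : ℕ, T.spin = n) ∧
        IsSymmetricFunction (Htilde k μ) ∧ IsSymmetricFunction (Hfun k μ)) :=
  ⟨fun lam => ⟨fun _ T => T.exists_cospin_eq hk, isSymmetricFunction_Gtilde hk lam⟩,
    fun μ => ⟨fun _ T => T.exists_spin_eq hk, isSymmetricFunction_Gtilde hk _,
      isSymmetricFunction_Hfun hk μ⟩⟩
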